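/- **Setting.** Fix a countable family of abstract domains, each an infinite set of constants (different domains may overlap). A schema is a finite list of relations, each attribute having an abstract domain, together with a finite list of access methods; an access method consists of a relation, a set of input attributes of that relation, and a flag "dependent" or "independent". Instances and configurations are finite sets of well-typed facts. The active domain $\mathrm{Adom}(\mathrm{Conf})$ is the set of pairs $(c,\mathcal C)$ such that $c$ occurs in a fact of $\mathrm{Conf}$ in an attribute with domain $\mathcal C$. An access $(m,b)$, i.e. a method $m$ with a binding $b$ of its input attributes to values of their domains, is *well-formed* at $\mathrm{Conf}$ if $m$ is independent, or if every input value, paired with the domain of its attribute, is in $\mathrm{Adom}(\mathrm{Conf})$. On an instance $I\supseteq \mathrm{Conf}$, a well-formed access leads from $\mathrm{Conf}$ to $\mathrm{Conf}\cup \mathrm{Resp}$ for any set $\mathrm{Resp}$ of facts of $I$ over the relation of $m$ that agree with $b$. A *path* on $I$ is a finite sequence of such steps, each access being well-formed at the configuration reached so far; $\mathrm{Conf}'$ is *reachable* from $\mathrm{Conf}$ if some path on some instance $I\supseteq\mathrm{Conf}$ leads from $\mathrm{Conf}$ to $\mathrm{Conf}'$. An access is *Boolean* if all attributes of its relation are input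 attributes. The queries are Boolean conjunctive queries (CQs) in which all occurrences of a variable are in attributes with the same domain, and whose constants are present in the configuration (paired with the domains of the attributes in which they occur). A CQ is *certain* at $\mathrm{Conf}$ if it is true in every instance $I\supseteq\mathrm{Conf}$. *Long-term relevance.* A well-formed access $(m,b)$ is long-term relevant for $Q$ at $\mathrm{Conf}$ if, for some instance $I\supseteq \mathrm{Conf}$ and some path $p$ on $I$ from $\mathrm{Conf}$ whose first access is $(m,b)$, the certainty of $Q$ at the end of $p$ differs from the certainty of $Q$ at the end of the truncated path of $p$: the path from $\mathrm{Conf}$ obtained by deleting the first step of $p$ and keeping the longest initial part of the remaining steps (with the same responses) whose accesses are all still well-formed. *Containment under access limitations.* $Q_1$ is contained in $Q_2$ under the access methods starting from $\mathrm{Conf}$ if $Q_2$ is true in every configuration reachable from $\mathrm{Conf}$ in which $Q_1$ is true. **Proposition.** There is a nondeterministic polynomial-time algorithm, with an oracle for containment of Boolean CQs under access limitations (input: schema with access methods, configuration, and two CQs), that decides long-term relevance: given a schema with access methods, a configuration, a Boolean CQ, and a Boolean access that is well-formed at the configuration, it decides whether the access is long-term relevant for the query at the configuration. -/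

import Mathlib

namespace DeepWeb

/-! ## Trees as data, nondeterministic oracle programs, and the class NP with an oracle -/

/-- Data values: finite binary trees (S-expressions over a single atom). -/
inductive STree : Type
  | nil : STree
  | node : STree → STree → STree
  deriving DecidableEq

namespace STree

/-- The number of nodes (leaves included). -/
def size : STree → ℕ
  | nil => 1
  | node l r => 1 + l.size + r.size

def hd : STree → STree
  | nil => nil
  | node l _ => l

def tl : STree → STree
  | nil => nil
  | node _ r => r

/-- The tree that stands for "false" is `nil`, the one for "true" is `node nil nil`. -/
def ofBool : Bool → STree
  | false => nil
  | true => node nil nil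

end STree

/-- Expressions over registers `0, 1, 2, …`, each of which holds a tree. -/
inductive Expr : Type
  | reg : ℕ → Expr
  | nil : Expr
  | cons : Expr → Expr → Expr
  | hd : Expr → Expr
  | tl : Expr → Expr
  | eq : Expr → Expr → Expr

namespace Expr

def eval (σ : ℕ → STree) : Expr → STree
  | reg i => σ i
  | nil => STree.nil
  | cons a b => STree.node (a.eval σ) (b.eval σ)
  | hd a => (a.eval σ).hd
  | tl a => (a.eval σ).tl
  | eq a b => STree.ofBool (decide (a.eval σ = b.eval σ))

/-- The time charged for evaluating an expression: the total size of the values of all its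
subexpressions. Since values are paid for in full (no free sharing), this is polynomially
related to the time of a Turing machine. -/
def cost (σ : ℕ → STree) : Expr → ℕ
  | reg i => (σ i).size
  | nil => 1
  | cons a b => (eval σ (cons a b)).size + a.cost σ + b.cost σ
  | hd a => (eval σ (hd a)).size + a.cost σ
  | tl a => (eval σ (tl a)).size + a.cost σ
  | eq a b => (eval σ (eq a b)).size + a.cost σ + b.cost σ

end Expr

/-- Nondeterministic while-programs with an oracle. -/
inductive Prog : Type
  | skip : Prog
  | assign : ℕ → Expr → Prog
  | seq : Prog → Prog → Prog
  | ite : Expr → Prog → Prog → Prog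
  | loop : Expr → Prog → Prog
  | choose : ℕ → Prog
  | query : ℕ → Expr → Prog

/-- A state: the contents of the registers, and the sequence of nondeterministic binary
choices that the branch of the computation under consideration is still going to make. -/
structure State : Type where
  reg : ℕ → STree
  coins : ℕ → Bool

def State.set (s : State) (i : ℕ) (t : STree) : State :=
  { s with reg := Function.update s.reg i t }

/-- `Exec Ω c s n s'`: with oracle `Ω`, program `c` started in `s` halts in `s'` after time `n`.
A branch (a sequence of choices) being part of the state, this is deterministic. -/
inductive Exec (Ω : Set STree) : Prog → State → ℕ → State → Prop
  | skip (s : State) : Exec Ω .skip s 1 s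
  | assign (i : ℕ) (e : Expr) (s : State) :
      Exec Ω (.assign i e) s (1 + e.cost s.reg) (s.set i (e.eval s.reg))
  | seq {c d : Prog} {s s₁ s₂ : State} {m n : ℕ} :
      Exec Ω c s m s₁ → Exec Ω d s₁ n s₂ → Exec Ω (.seq c d) s (1 + m + n) s₂
  | ite_true {e : Expr} {c d : Prog} {s s₁ : State} {n : ℕ} :
      e.eval s.reg ≠ .nil → Exec Ω c s n s₁ → Exec Ω (.ite e c d) s (1 + e.cost s.reg + n) s₁
  | ite_false {e : Expr} {c d : Prog} {s s₁ : State} {n : ℕ} :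
      e.eval s.reg = .nil → Exec Ω d s n s₁ → Exec Ω (.ite e c d) s (1 + e.cost s.reg + n) s₁
  | loop_done {e : Expr} {c : Prog} {s : State} :
      e.eval s.reg = .nil → Exec Ω (.loop e c) s (1 + e.cost s.reg) s
  | loop_step {e : Expr} {c : Prog} {s s₁ s₂ : State} {m n : ℕ} :
      e.eval s.reg ≠ .nil → Exec Ω c s m s₁ → Exec Ω (.loop e c) s₁ n s₂ →
      Exec Ω (.loop e c) s (1 + e.cost s.reg + m + n) s₂
  | choose (i : ℕ) (s : State) :
      Exec Ω (.choose i) s 1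
        { reg := Function.update s.reg i (STree.ofBool (s.coins 0))
          coins := fun k => s.coins (k + 1) }
  | query_yes {e : Expr} {i : ℕ} {s : State} :
      e.eval s.reg ∈ Ω →
      Exec Ω (.query i e) s (1 + e.cost s.reg) (s.set i (STree.ofBool true))
  | query_no {e : Expr} {i : ℕ} {s : State} :
      e.eval s.reg ∉ Ω →
      Exec Ω (.query i e) s (1 + e.cost s.reg) (s.set i (STree.ofBool false))

/-- The input is in register `0`; all other registers are empty. -/
def initState (x : STree) (ρ : ℕ → Bool) : State :=
  { reg := fun i => if i = 0 then x else .nil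
    coins := ρ }

/-- An injective encoding of the objects of `α` by trees. -/
class TreeEncoding (α : Type) where
  enc : α → STree
  enc_injective : Function.Injective enc

/-- `P` is decided by a nondeterministic polynomial-time algorithm with an oracle for `O`:
there are a program and a polynomial such that, on every input `x`, every branch halts in time
polynomial in the size of the input, and `P x` holds iff some branch accepts (ends with a value
different from `nil` in register `0`). The oracle answers "yes" exactly on the encodings of the
objects that satisfy `O`. -/
def InNPOracle {α β : Type} [TreeEncoding α] [TreeEncoding β] (P : α → Prop) (O : β → Prop) :
    Prop :=
  ∃ (c : Prog) (p : Polynomial ℕ), ∀ x : α,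
    (∀ ρ : ℕ → Bool, ∃ (n : ℕ) (s : State),
      Exec (TreeEncoding.enc '' {y | O y}) c (initState (TreeEncoding.enc x) ρ) n s ∧
        n ≤ p.eval (TreeEncoding.enc x).size) ∧
    (P x ↔ ∃ (ρ : ℕ → Bool) (n : ℕ) (s : State),
      Exec (TreeEncoding.enc '' {y | O y}) c (initState (TreeEncoding.enc x) ρ) n s ∧
        s.reg 0 ≠ .nil)

/-! ### Encodings of basic data -/

def encList {α : Type} (f : α → STree) : List α → STree
  | [] => .nil
  | a :: l => .node (f a) (encList f l)

theorem encList_injective {α : Type} {f : α → STree} (hf : Function.Injective f) :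
    Function.Injective (encList f) := by
  intro l
  induction l with
  | nil => intro m h; cases m with
    | nil => rfl
    | cons b m => simp [encList] at h
  | cons a l ih => intro m h; cases m with
    | nil => simp [encList] at h
    | cons b m =>
      simp only [encList, STree.node.injEq] at h
      rw [hf h.1, ih h.2]

instance : TreeEncoding Bool where
  enc := STree.ofBool
  enc_injective := by
    intro a b h
    cases a <;> cases b <;> simp_all [STree.ofBool]

instance {α : Type} [TreeEncoding α] : TreeEncoding (List α) where
  enc := encList TreeEncoding.enc
  enc_injective := encList_injective TreeEncoding.enc_injective

instance {α β : Type} [TreeEncoding α] [TreeEncoding β] : TreeEncoding (α × β) where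
  enc := fun x => .node (TreeEncoding.enc x.1) (TreeEncoding.enc x.2)
  enc_injective := by
    rintro ⟨a, b⟩ ⟨c, d⟩ h
    simp only [STree.node.injEq] at h
    rw [TreeEncoding.enc_injective h.1, TreeEncoding.enc_injective h.2]

instance {α : Type} [TreeEncoding α] : TreeEncoding (Option α) where
  enc := fun x => match x with
    | none => .nil
    | some a => .node .nil (TreeEncoding.enc a)
  enc_injective := by
    intro a b h
    cases a <;> cases b <;> simp at h
    · rfl
    · rw [TreeEncoding.enc_injective h]

/-! ## Schemas, access methods, configurations, accesses -/

/-- Constants, variables, relation names and names of abstract domains are bit strings. -/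
abbrev Name : Type := List Bool

/-- An access method on the relation `rel`: `input` tells for each attribute of the relation
whether it is an input attribute; a method is dependent or (`dependent = false`) independent. -/
structure AccessMethod : Type where
  rel : Name
  input : List Bool
  dependent : Bool

/-- A relational schema together with a set of access methods: `rels` lists the relations, each
with the abstract domains of its attributes. -/
structure Schema : Type where
  rels : List (Name × List Name)
  methods : List AccessMethod

/-- Distinct relations have distinct names, and each access method is on a relation of the
schema. -/
def Schema.Valid (S : Schema) : Prop :=
  (S.rels.map Prod.fst).Nodup ∧
    ∀ m ∈ S.methods, ∃ ds, (m.rel, ds) ∈ S.rels ∧ m.input.length = ds.length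

/-- A ground fact: a relation name and a tuple of constants. -/
abbrev Fact : Type := Name × List Name

/-- `dom d` is the set of constants of the abstract domain named `d`. A fact is well-typed if its
relation is in the schema and its values are in the domains of the attributes. -/
def WellTyped (dom : Name → Set Name) (S : Schema) (f : Fact) : Prop :=
  ∃ ds, (f.1, ds) ∈ S.rels ∧ List.Forall₂ (fun c d => c ∈ dom d) f.2 ds

/-- Database instances, and also configurations, over `S`: finite sets of well-typed facts. -/
def IsInstance (dom : Name → Set Name) (S : Schema) (I : Finset Fact) : Prop :=
  ∀ f ∈ I, WellTyped dom S f

/-- The active domain: the constants that occur in `C`, paired with the abstract domains of the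
attributes in which they occur. -/
def adom (S : Schema) (C : Finset Fact) : Set (Name × Name) :=
  {cd | ∃ f ∈ C, ∃ ds, (f.1, ds) ∈ S.rels ∧ cd ∈ f.2.zip ds}

/-- An access: a method and a binding. The binding is a tuple with a value at each input attribute
and `none` (written "?") at each output attribute. -/
structure Access : Type where
  method : AccessMethod
  bind : List (Option Name)

/-- There are no output attributes. -/
def Access.IsBoolean (a : Access) : Prop := ∀ b ∈ a.method.input, b = true

/-- `a` is a well-formed access at the configuration `C`. -/
def Access.WellFormed (dom : Name → Set Name) (S : Schema) (C : Finset Fact) (a : Access) :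
    Prop :=
  a.method ∈ S.methods ∧ a.bind.map Option.isSome = a.method.input ∧
    ∃ ds, (a.method.rel, ds) ∈ S.rels ∧
      ∀ c d, (some c, d) ∈ a.bind.zip ds →
        c ∈ dom d ∧ (a.method.dependent = true → (c, d) ∈ adom S C)

/-- The fact `f` is in the accessed relation and agrees with the binding. -/
def Access.Matches (a : Access) (f : Fact) : Prop :=
  f.1 = a.method.rel ∧ List.Forall₂ (fun o c => ∀ v, o = some v → c = v) a.bind f.2

/-- An access together with a response to it. -/
structure AccessStep : Type where
  access : Access
  resp : Finset Fact

/-- On the instance `I`, the access is well-formed at `C` and the response is sound: it consists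
of some (not necessarily all) tuples of `I` that agree with the binding. The successor
configuration is then `C ∪ s.resp`. -/
def AccessStep.Legal (dom : Name → Set Name) (S : Schema) (I C : Finset Fact) (s : AccessStep) :
    Prop :=
  s.access.WellFormed dom S C ∧ ∀ f ∈ s.resp, f ∈ I ∧ s.access.Matches f

/-- The configuration in which the sequence of accesses and responses `p` from `C` ends. -/
def endConf (C : Finset Fact) : List AccessStep → Finset Fact
  | [] => C
  | s :: p => endConf (C ∪ s.resp) p

/-- `p` is a path on the instance `I` starting from the configuration `C`. -/
def IsPath (dom : Name → Set Name) (S : Schema) (I : Finset Fact) :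
    Finset Fact → List AccessStep → Prop
  | _, [] => True
  | C, s :: p => s.Legal dom S I C ∧ IsPath dom S I (C ∪ s.resp) p

open Classical in
/-- The longest initial part of `p` (with the same responses) all of whose accesses are
well-formed when starting from `C`. -/
noncomputable def wellFormedPrefix (dom : Name → Set Name) (S : Schema) :
    Finset Fact → List AccessStep → List AccessStep
  | _, [] => []
  | C, s :: p =>
      if s.access.WellFormed dom S C then s :: wellFormedPrefix dom S (C ∪ s.resp) p else []

/-- The truncated path of a path `p` from `C`: the initial access is eliminated, and then the
longest part that does not depend on it is kept. -/
noncomputable def truncatedPath (dom : Name → Set Name) (S : Schema) (C : Finset Fact)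
    (p : List AccessStep) : List AccessStep :=
  wellFormedPrefix dom S C p.tail

/-- `C'` is reachable from `C` by well-formed accesses (on some instance consistent with `C`). -/
def Reachable (dom : Name → Set Name) (S : Schema) (C C' : Finset Fact) : Prop :=
  ∃ I, IsInstance dom S I ∧ C ⊆ I ∧ ∃ p, IsPath dom S I C p ∧ endConf C p = C'

/-! ## Boolean conjunctive queries -/

inductive Term : Type
  | var : Name → Term
  | const : Name → Term

def Term.eval (h : Name → Name) : Term → Name
  | var x => h x
  | const c => c

/-- A subgoal: a relation name applied to variables and constants. -/
structure Atom : Type where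
  rel : Name
  args : List Term

/-- A Boolean conjunctive query, all of whose variables are existentially quantified, given by
the list of its subgoals. -/
abbrev CQ : Type := List Atom

/-- The truth of a Boolean conjunctive query in a finite set of facts. -/
def CQ.Holds (Q : CQ) (I : Finset Fact) : Prop :=
  ∃ h : Name → Name, ∀ A ∈ Q, (A.rel, A.args.map (Term.eval h)) ∈ I

/-- The term `t` occurs in the query in an attribute with domain `d`. -/
def CQ.Occurs (S : Schema) (Q : CQ) (t : Term) (d : Name) : Prop :=
  ∃ A ∈ Q, ∃ ds, (A.rel, ds) ∈ S.rels ∧ (t, d) ∈ A.args.zip ds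

/-- `Q` is a query over the schema, its variables respect the domains, and its constants are
present in the configuration `C`. -/
def CQ.Valid (S : Schema) (C : Finset Fact) (Q : CQ) : Prop :=
  (∀ A ∈ Q, ∃ ds, (A.rel, ds) ∈ S.rels ∧ A.args.length = ds.length) ∧
  (∀ x d d', CQ.Occurs S Q (.var x) d → CQ.Occurs S Q (.var x) d' → d = d') ∧
  (∀ c d, CQ.Occurs S Q (.const c) d → (c, d) ∈ adom S C)

/-- `Q` is certain at `C`: it is true in all instances consistent with `C`. -/
def CQ.Certain (dom : Name → Set Name) (S : Schema) (C : Finset Fact) (Q : CQ) : Prop :=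
  ∀ I, IsInstance dom S I → C ⊆ I → CQ.Holds Q I

/-! ## Long-term relevance and containment under access limitations -/

/-- The access `a` is long-term relevant for `Q` at the configuration `C`. -/
def LongTermRelevant (dom : Name → Set Name) (S : Schema) (C : Finset Fact) (Q : CQ)
    (a : Access) : Prop :=
  ∃ I, IsInstance dom S I ∧ C ⊆ I ∧ ∃ p, IsPath dom S I C p ∧
    (∃ s q, p = s :: q ∧ s.access = a) ∧
    ¬ (CQ.Certain dom S (endConf C p) Q ↔
        CQ.Certain dom S (endConf C (truncatedPath dom S C p)) Q)

/-- `Q₁` is contained in `Q₂` under the access limitations starting from `C`. -/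
def ContainedFrom (dom : Name → Set Name) (S : Schema) (C : Finset Fact) (Q₁ Q₂ : CQ) : Prop :=
  ∀ C', Reachable dom S C C' → CQ.Holds Q₁ C' → CQ.Holds Q₂ C'

/-- Inputs of the problem "is a Boolean access long-term relevant for a conjunctive query?":
a schema with access methods, a configuration, a query, and a well-formed Boolean access. -/
@[ext]
structure RelevanceInput (dom : Name → Set Name) : Type where
  schema : Schema
  conf : List Fact
  query : CQ
  access : Access
  schema_valid : schema.Valid
  conf_valid : IsInstance dom schema conf.toFinset
  query_valid : CQ.Valid schema conf.toFinset query
  access_wellFormed : access.WellFormed dom schema conf.toFinset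
  access_boolean : access.IsBoolean

/-- Inputs of the problem of containment of conjunctive queries under access limitations:
a schema with access methods, a configuration, and two queries. -/
@[ext]
structure ContainmentInput (dom : Name → Set Name) : Type where
  schema : Schema
  conf : List Fact
  query₁ : CQ
  query₂ : CQ
  schema_valid : schema.Valid
  conf_valid : IsInstance dom schema conf.toFinset
  query₁_valid : CQ.Valid schema conf.toFinset query₁
  query₂_valid : CQ.Valid schema conf.toFinset query₂

/-- The problem of long-term relevance of a Boolean access for a conjunctive query. -/
def RelevanceProblem (dom : Name → Set Name) (x : RelevanceInput dom) : Prop :=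
  LongTermRelevant dom x.schema x.conf.toFinset x.query x.access

/-- The problem of containment of conjunctive queries under access limitations. -/
def ContainmentProblem (dom : Name → Set Name) (y : ContainmentInput dom) : Prop :=
  ContainedFrom dom y.schema y.conf.toFinset y.query₁ y.query₂

/-! ### Encodings of the inputs -/

instance : TreeEncoding AccessMethod where
  enc := fun m => TreeEncoding.enc (m.rel, m.input, m.dependent)
  enc_injective := by
    rintro ⟨a, b, c⟩ ⟨a', b', c'⟩ h
    simpa using TreeEncoding.enc_injective h

instance : TreeEncoding Schema where
  enc := fun S => TreeEncoding.enc (S.rels, S.methods)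
  enc_injective := by
    rintro ⟨a, b⟩ ⟨a', b'⟩ h
    simpa using TreeEncoding.enc_injective h

instance : TreeEncoding Access where
  enc := fun a => TreeEncoding.enc (a.method, a.bind)
  enc_injective := by
    rintro ⟨a, b⟩ ⟨a', b'⟩ h
    simpa using TreeEncoding.enc_injective h

instance : TreeEncoding Term where
  enc := fun t => match t with
    | .var x => TreeEncoding.enc (false, x)
    | .const c => TreeEncoding.enc (true, c)
  enc_injective := by
    intro s t h
    cases s <;> cases t <;> simpa using TreeEncoding.enc_injective h

instance : TreeEncoding Atom where
  enc := fun A => TreeEncoding.enc (A.rel, A.args)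
  enc_injective := by
    rintro ⟨a, b⟩ ⟨a', b'⟩ h
    simpa using TreeEncoding.enc_injective h

instance (dom : Name → Set Name) : TreeEncoding (RelevanceInput dom) where
  enc := fun x => TreeEncoding.enc (x.schema, x.conf, x.query, x.access)
  enc_injective := by
    intro x y h
    have := TreeEncoding.enc_injective h
    simp only [Prod.mk.injEq] at this
    exact RelevanceInput.ext this.1 this.2.1 this.2.2.1 this.2.2.2

instance (dom : Name → Set Name) : TreeEncoding (ContainmentInput dom) where
  enc := fun x => TreeEncoding.enc (x.schema, x.conf, x.query₁, x.query₂)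
  enc_injective := by
    intro x y h
    have := TreeEncoding.enc_injective h
    simp only [Prod.mk.injEq] at this
    exact ContainmentInput.ext this.1 this.2.1 this.2.2.1 this.2.2.2

end DeepWeb

namespace DeepWeb

/-! ## Costs of expressions -/

namespace STree

/-! A Boolean access can return only one fact F = (r, t), or nothing. With an empty response a path
equals its own truncation, and certainty at a configuration is truth there. So relevance means: some
path q from C ∪ {F} makes Q true, while Q is false where q gets stuck when started from C
(`longTermRelevant_iff`).

To speak about this by containment, F is separated into its two roles. Add a fresh relation n with
the domains of r and no access method, and store t there instead of in r. The active domain is that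
of C ∪ {F}, so exactly the same accesses are possible (`reachable_extend_iff`), but F itself is no
longer available to r-atoms of Q.

If Q fails at the end of q without F, then Q uses F as a fact. Redirecting to n the atoms that were
mapped to F gives a query Q' that is true where Q is false, so Q' is not contained in Q. Conversely
such a non-containment gives relevance, because the truncation ends in a subset of the configuration
where Q is false (`longTermRelevant_of_redirect`).

If Q holds without F, then F matters only by enabling accesses. The first blocked step uses a
dependent method m with an input value c of domain d that comes from t and is new. At that point Q
is false although every input domain of m is inhabited; the latter is expressed by the query that
certain relations are nonempty. Conversely, suppose a path p from C ∪ {F} inhabits the input domains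
of m and leaves Q false, and that Q is reachable from C ∪ {F}. If p is already blocked from C,
append a path that makes Q true. Otherwise rename c in domain d to a fresh value along p
(`exists_path_avoiding`; this is where infinite domains enter), insert an access by m that uses c
and returns nothing, and then make Q true: the truncation stops at the inserted access
(`longTermRelevant_of_new_access`).

The algorithm guesses n, its domains, t, Q', m and the domains of m. The oracle is also used for
bookkeeping: Q' ⊆ Q' is answered "yes" exactly on valid inputs, so it validates the guess; validity
of a query with the constant c tests membership in the active domain; containment in the query for
an empty nullary relation tests unreachability. A small language of checks with bounded list
quantifiers is compiled once and for all to polynomial-time programs (`Chk.exec_compile`), and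
`inNPOracle_of_check` adds the guessing phase. -/

theorem size_pos (t : STree) : 1 ≤ t.size := by cases t <;> simp [size]; omega

theorem size_hd_le (t : STree) : t.hd.size ≤ t.size := by cases t <;> simp [size, hd]; omega

theorem size_tl_le (t : STree) : t.tl.size ≤ t.size := by cases t <;> simp [size, tl]

theorem size_ofBool_le (b : Bool) : (ofBool b).size ≤ 3 := by cases b <;> simp [ofBool, size]

@[simp] theorem ofBool_eq_nil (b : Bool) : ofBool b = nil ↔ b = false := by
  cases b <;> simp [ofBool]

/-- The list of trees that a tree encodes. -/
def elems : STree → List STree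
  | nil => []
  | node h t => h :: t.elems

/-- The sum of the sizes of the members of a list of trees. -/
def weight : STree → ℕ
  | nil => 0
  | node h t => h.size + t.weight

end STree

namespace Expr

/-- The registers read by an expression. -/
def reads : Expr → List ℕ
  | reg i => [i]
  | nil => []
  | cons a b => a.reads ++ b.reads
  | hd a => a.reads
  | tl a => a.reads
  | eq a b => a.reads ++ b.reads

/-- A constant `k` such that the cost of the expression is at most `k` times the size of the
registers that it reads. -/
def factor : Expr → ℕ
  | reg _ => 1
  | nil => 1
  | cons a b => 1 + 2 * a.factor + 2 * b.factor
  | hd a => 2 * a.factor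
  | tl a => 2 * a.factor
  | eq a b => 3 + a.factor + b.factor

theorem size_eval_le_cost (σ : ℕ → STree) (e : Expr) : (e.eval σ).size ≤ e.cost σ := by
  cases e <;> simp [eval, cost, STree.size] <;> omega

/-- The size of a value is at most the cost of computing it, so each constructor inflates the bound
only by a constant. The factor depends on the expression alone, which makes compiled checks
polynomial. -/
theorem cost_le (σ : ℕ → STree) (B : ℕ) (hB : 1 ≤ B) (e : Expr)
    (h : ∀ i ∈ e.reads, (σ i).size ≤ B) : e.cost σ ≤ e.factor * B := by
  induction e with
  | reg i => simpa [cost, factor, reads] using h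
  | nil => simpa [cost, factor] using hB
  | cons a b iha ihb =>
    simp only [reads, List.mem_append] at h
    have ha := iha fun i hi => h i (.inl hi)
    have hb := ihb fun i hi => h i (.inr hi)
    have h1 := size_eval_le_cost σ a
    have h2 := size_eval_le_cost σ b
    simp only [cost, factor, eval, STree.size]
    nlinarith
  | hd a iha =>
    have ha := iha h
    have h1 := size_eval_le_cost σ a
    have h2 := (a.eval σ).size_hd_le
    simp only [cost, factor, eval]
    nlinarith
  | tl a iha =>
    have ha := iha h
    have h1 := size_eval_le_cost σ a
    have h2 := (a.eval σ).size_tl_le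
    simp only [cost, factor, eval]
    nlinarith
  | eq a b iha ihb =>
    simp only [reads, List.mem_append] at h
    have ha := iha fun i hi => h i (.inl hi)
    have hb := ihb fun i hi => h i (.inr hi)
    have h1 := STree.size_ofBool_le (decide (a.eval σ = b.eval σ))
    simp only [cost, factor, eval]
    nlinarith

theorem eval_congr {σ τ : ℕ → STree} (e : Expr) (h : ∀ i ∈ e.reads, σ i = τ i) :
    e.eval σ = e.eval τ := by
  induction e with
  | reg i => simpa [eval, reads] using h
  | nil => rfl
  | cons a b iha ihb | eq a b iha ihb =>
    simp only [reads, List.mem_append] at h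
    simp only [eval, iha fun i hi => h i (.inl hi), ihb fun i hi => h i (.inr hi)]
  | hd a iha | tl a iha => simp only [eval, iha h]

end Expr

@[simp] theorem State.set_reg_self (s : State) (i : ℕ) (t : STree) : (s.set i t).reg i = t := by
  simp [State.set]

theorem State.set_reg_ne (s : State) {i j : ℕ} (t : STree) (h : j ≠ i) :
    (s.set i t).reg j = s.reg j := by
  simp [State.set, h]

@[simp] theorem State.set_coins (s : State) (i : ℕ) (t : STree) : (s.set i t).coins = s.coins :=
  rfl

theorem eval_polynomial_mono (p : Polynomial ℕ) : Monotone fun x => p.eval x := by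
  intro x y h
  induction p using Polynomial.induction_on' with
  | add p q hp hq => simpa using add_le_add hp hq
  | monomial n a => simpa using Nat.mul_le_mul_left a (Nat.pow_le_pow_left h n)

/-! ## A language of checks, and its compilation to programs -/

/-- Checks on the contents of registers. In `all2 a b c`, the check `c` is made for the members of
the lists `a` and `b` in parallel. -/
inductive Chk : Type
  | eq : Expr → Expr → Chk
  | not : Chk → Chk
  | and : Chk → Chk → Chk
  | oracle : Expr → Chk
  | all2 : Expr → Expr → Chk → Chk

namespace Chk

/-- The meaning of a check at level `n`: a quantifier at level `n` binds the registers
`n + 1` and `n + 2`. -/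
def Holds (Ω : Set STree) : ℕ → (ℕ → STree) → Chk → Prop
  | _, σ, eq a b => a.eval σ = b.eval σ
  | n, σ, not c => ¬ Holds Ω n σ c
  | n, σ, and c d => Holds Ω n σ c ∧ Holds Ω n σ d
  | _, σ, oracle e => e.eval σ ∈ Ω
  | n, σ, all2 a b c =>
      List.Forall₂
        -- Register n is for the result, n + 1 and n + 2 for the current members, n + 3 and n + 4
        -- for the remaining lists; hence the body lives at level n + 5.
        (fun t u => Holds Ω (n + 5) (Function.update (Function.update σ (n + 1) t) (n + 2) u) c)
        (a.eval σ).elems (b.eval σ).elems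

/-- A check at level `n` reads only registers in `V` and bound ones. -/
def Closed : List ℕ → ℕ → Chk → Prop
  | V, _, eq a b => (∀ i ∈ a.reads, i ∈ V) ∧ ∀ i ∈ b.reads, i ∈ V
  | V, n, not c => Closed V n c
  | V, n, and c d => Closed V n c ∧ Closed V n d
  | V, _, oracle e => ∀ i ∈ e.reads, i ∈ V
  | V, n, all2 a b c => (∀ i ∈ a.reads, i ∈ V) ∧ (∀ i ∈ b.reads, i ∈ V) ∧
      Closed ((n + 1) :: (n + 2) :: V) (n + 5) c

/-- The body of the loop for `all2`. -/
def loopBody (n : ℕ) (c : Prog) : Prog :=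
  .seq (.assign (n + 1) (.hd (.reg (n + 3)))) <|
  .seq (.assign (n + 2) (.hd (.reg (n + 4)))) <|
  .seq c <|
  -- If the second list is already exhausted, `c` was run on the dummy head `nil`; its result is
  -- ignored and the conjunction becomes false.
  .seq (.ite (.reg (n + 4)) (.ite (.reg (n + 5)) .skip (.assign n .nil)) (.assign n .nil)) <|
  .seq (.assign (n + 3) (.tl (.reg (n + 3)))) (.assign (n + 4) (.tl (.reg (n + 4))))

/-- The program that evaluates a check; its result is put into register `n`, and it writes no
register below `n`. -/
def compile : ℕ → Chk → Prog
  | n, eq a b => .assign n (.eq a b)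
  | n, not c => .seq (compile n c) (.assign n (.eq (.reg n) .nil))
  | n, and c d => .seq (compile n c) (.ite (.reg n) (compile n d) .skip)
  | n, oracle e => .query n e
  | n, all2 a b c =>
      .seq (.assign (n + 3) a) <| .seq (.assign (n + 4) b) <|
      .seq (.assign n (.cons .nil .nil)) <|
      .seq (.loop (.reg (n + 3)) (loopBody n (compile (n + 5) c)))
        (.ite (.reg (n + 4)) (.assign n .nil) .skip)

open Polynomial in
/-- A bound for the time of the compiled check in terms of the size of the registers it reads. -/
noncomputable def time : Chk → Polynomial ℕ
  | eq a b => 1 + C (Expr.eq a b).factor * X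
  | not c => c.time + 10
  | and c d => c.time + d.time + 10
  | oracle e => 1 + C e.factor * X
  | all2 a b c =>
      C (a.factor + b.factor + 1) * X *
        (c.time.comp (C (a.factor + b.factor + 1) * X) + 20 * (C (a.factor + b.factor + 1) * X)
          + 40) +
        (20 * (C (a.factor + b.factor + 1) * X) + 40)

open Classical in
-- The first list drives the loop, and `p` is the truth value accumulated so far. A second list that
-- is too short falsifies register n, one that is too long leaves a remainder in register n + 4; the
-- conclusion therefore speaks of both registers.
theorem exec_loop (Ω : Set STree) (n : ℕ) (c : Prog) (s₀ : State) (P : STree → STree → Prop)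
    (L T : ℕ)
    (hc : ∀ s : State, (∀ i < n, s.reg i = s₀.reg i) →
      (s.reg (n + 1)).size ≤ L → (s.reg (n + 2)).size ≤ L → ∃ m s', Exec Ω c s m s' ∧ m ≤ T ∧
        (∀ i < n + 5, s'.reg i = s.reg i) ∧ s'.coins = s.coins ∧
        s'.reg (n + 5) = STree.ofBool (decide (P (s.reg (n + 1)) (s.reg (n + 2)))))
    (t : STree) : ∀ (u : STree) (p : Prop) (s : State), (∀ i < n, s.reg i = s₀.reg i) →
      s.coins = s₀.coins → s.reg (n + 3) = t → s.reg (n + 4) = u →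
      s.reg n = STree.ofBool (decide p) → t.size ≤ L → u.size ≤ L →
      ∃ m s', Exec Ω (.loop (.reg (n + 3)) (loopBody n c)) s m s' ∧
        m ≤ t.size * (T + 20 * L + 40) ∧
        (∀ i < n, s'.reg i = s₀.reg i) ∧ s'.coins = s₀.coins ∧
        (s'.reg (n + 4)).size ≤ L ∧
        (∃ b, s'.reg n = STree.ofBool b) ∧
        ((s'.reg (n + 4) = .nil ∧ s'.reg n ≠ .nil) ↔ p ∧ List.Forall₂ P t.elems u.elems) := by
  induction t with
  | nil =>
    intro u p s hs hcn h3 h4 hn ht hu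
    refine ⟨_, s, .loop_done (by simpa [Expr.eval] using h3), ?_, hs, hcn, h4 ▸ hu, ⟨_, hn⟩, ?_⟩
    · simp [Expr.cost, h3, STree.size]
    · rw [h4, hn]
      cases u <;> simp [STree.elems]
  | node h t _ iht =>
    intro u p s hs hcn h3 h4 hn ht hu
    have hL : 1 ≤ L := le_trans (STree.size_pos _) ht
    have hh : h.size ≤ L := by simp [STree.size] at ht; omega
    have ht' : t.size ≤ L := by simp [STree.size] at ht; omega
    have hu1 := le_trans u.size_hd_le hu
    have hu2 := le_trans u.size_tl_le hu
    set s1 := s.set (n + 1) h with hs1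
    set s2 := s1.set (n + 2) u.hd with hs2
    obtain ⟨m, s3, e3, hm, hr3, hc3, hb3⟩ := hc s2
      (fun i hi => by
        rw [hs2, State.set_reg_ne _ _ (by omega), hs1, State.set_reg_ne _ _ (by omega), hs i hi])
      (by rw [hs2, State.set_reg_ne _ _ (by omega)]; simpa [hs1] using hh) (by simpa [hs2] using hu1)
    have g1 : s2.reg (n + 1) = h := by
      rw [hs2, State.set_reg_ne _ _ (by omega)]; simp [hs1]
    have g2 : s2.reg (n + 2) = u.hd := by simp [hs2]
    have g : ∀ i, i ≠ n + 1 → i ≠ n + 2 → s2.reg i = s.reg i := fun i h1 h2 => by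
      rw [hs2, State.set_reg_ne _ _ h2, hs1, State.set_reg_ne _ _ h1]
    rw [g1, g2] at hb3
    have k3 : s3.reg (n + 3) = .node h t := by
      rw [hr3 _ (by omega), g _ (by omega) (by omega), h3]
    have k4 : s3.reg (n + 4) = u := by
      rw [hr3 _ (by omega), g _ (by omega) (by omega), h4]
    have kn : s3.reg n = STree.ofBool (decide p) := by
      rw [hr3 _ (by omega), g _ (by omega) (by omega), hn]
    -- the update of the result
    obtain ⟨m4, s4, e4, hm4, hr4, hc4, hn4⟩ : ∃ m s', Exec Ω (.ite (.reg (n + 4))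
        (.ite (.reg (n + 5)) .skip (.assign n .nil)) (.assign n .nil)) s3 m s' ∧ m ≤ L + 10 ∧
        (∀ i, i ≠ n → s'.reg i = s3.reg i) ∧ s'.coins = s3.coins ∧
        s'.reg n = STree.ofBool (decide (p ∧ u ≠ .nil ∧ P h u.hd)) := by
      by_cases hu0 : u = .nil
      · refine ⟨_, _, .ite_false (by simpa [Expr.eval, k4] using hu0) (.assign _ _ _), ?_,
          fun i hi => State.set_reg_ne _ _ hi, rfl, ?_⟩
        · simp [Expr.cost, k4, hu0, STree.size]
        · simp [Expr.eval, hu0, STree.ofBool]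
      · by_cases hP : P h u.hd
        · refine ⟨_, _, .ite_true (by simpa [Expr.eval, k4] using hu0)
            (.ite_true (by simp [Expr.eval, hb3, hP]) (.skip _)), ?_, fun i hi => rfl, rfl, ?_⟩
          · simp [Expr.cost, k4, hb3, hP, STree.size, STree.ofBool]; omega
          · simp [kn, hu0, hP]
        · refine ⟨_, _, .ite_true (by simpa [Expr.eval, k4] using hu0)
            (.ite_false (by simp [Expr.eval, hb3, hP]) (.assign _ _ _)), ?_,
            fun i hi => State.set_reg_ne _ _ hi, rfl, ?_⟩
          · simp [Expr.cost, k4, hb3, hP, STree.size, STree.ofBool]; omega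
          · simp [Expr.eval, hP, STree.ofBool]
    set s5 := s4.set (n + 3) t with hs5
    set s6 := s5.set (n + 4) u.tl with hs6
    have k5 : s5.reg (n + 4) = u := by
      rw [hs5, State.set_reg_ne _ _ (by omega), hr4 _ (by omega), k4]
    have k6 : s4.reg (n + 3) = .node h t := by rw [hr4 _ (by omega), k3]
    obtain ⟨m7, s7, e7, hm7, hr7, hc7, hz7, hb7, hi7⟩ := iht u.tl (p ∧ u ≠ .nil ∧ P h u.hd) s6
      (fun i hi => by
        rw [hs6, State.set_reg_ne _ _ (by omega), hs5, State.set_reg_ne _ _ (by omega),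
          hr4 _ (by omega), hr3 _ (by omega), g _ (by omega) (by omega), hs i hi])
      (by simp [hs6, hs5, hc4, hc3, hs2, hs1, hcn])
      (by rw [hs6, State.set_reg_ne _ _ (by omega)]; simp [hs5])
      (by simp [hs6])
      (by
        rw [hs6, State.set_reg_ne _ _ (by omega), hs5, State.set_reg_ne _ _ (by omega), hn4]
        congr 1
        simp only [decide_eq_decide])
      ht' hu2
    have q4 : s1.reg (n + 4) = u := by rw [hs1, State.set_reg_ne _ _ (by omega), h4]
    have e1 := Exec.assign (Ω := Ω) (n + 1) (.hd (.reg (n + 3))) s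
    have e2 := Exec.assign (Ω := Ω) (n + 2) (.hd (.reg (n + 4))) s1
    have e5 := Exec.assign (Ω := Ω) (n + 3) (.tl (.reg (n + 3))) s4
    have e6 := Exec.assign (Ω := Ω) (n + 4) (.tl (.reg (n + 4))) s5
    simp only [Expr.eval, h3, STree.hd] at e1
    simp only [Expr.eval, q4] at e2
    simp only [Expr.eval, k6, STree.tl] at e5
    simp only [Expr.eval, k5] at e6
    have e8 := Exec.seq e1 (.seq e2 (.seq e3 (.seq e4 (.seq e5 e6))))
    refine ⟨_, s7, .loop_step (by simp [Expr.eval, h3]) e8 e7, ?_, hr7, hc7, hz7, hb7, ?_⟩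
    · simp only [Expr.cost, Expr.eval, h3, q4, k5, k6]
      rw [show (STree.node h t).hd = h from rfl, show (STree.node h t).tl = t from rfl]
      have : (STree.node h t).size = 1 + h.size + t.size := rfl
      have hX : (1 + h.size + t.size) * (T + 20 * L + 40) =
        (T + 20 * L + 40) + h.size * (T + 20 * L + 40) + t.size * (T + 20 * L + 40) := by ring
      rw [this, hX]
      rw [this] at ht
      omega
    · rw [hi7]
      cases u with
      | nil => simp [STree.elems]
      | node a b => simp [STree.elems, STree.hd, STree.tl]; tauto

open Classical in
/-- The compiled program computes the truth value of the check, in polynomial time. -/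
theorem exec_compile (Ω : Set STree) (c : Chk) : ∀ (V : List ℕ) (n : ℕ) (σ : ℕ → STree) (B : ℕ)
    (s : State), c.Closed V n → (∀ i ∈ V, i < n) → (∀ i ∈ V, s.reg i = σ i) →
    (∀ i ∈ V, (σ i).size ≤ B) → 1 ≤ B → ∃ m s', Exec Ω (c.compile n) s m s' ∧
      m ≤ c.time.eval B ∧ (∀ i < n, s'.reg i = s.reg i) ∧ s'.coins = s.coins ∧
      s'.reg n = STree.ofBool (decide (c.Holds Ω n σ)) := by
  induction c with
  | eq a b =>
    intro V n σ B s hW hV hs hB h1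
    have hr : ∀ i ∈ (Expr.eq a b).reads, i ∈ V := by
      simp only [Expr.reads, List.mem_append]
      rintro i (hi | hi)
      exacts [hW.1 i hi, hW.2 i hi]
    refine ⟨_, _, .assign _ _ _, ?_, fun i hi => State.set_reg_ne _ _ (by omega), rfl, ?_⟩
    · have := Expr.cost_le s.reg B h1 (.eq a b) fun i hi => by
        rw [hs i (hr i hi)]; exact hB i (hr i hi)
      simp [time]; omega
    · rw [State.set_reg_self, Expr.eval_congr _ fun i hi => hs i (hr i hi)]
      simp only [Expr.eval, Holds]
      by_cases h : a.eval σ = b.eval σ <;> simp [h]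
  | not c ih =>
    intro V n σ B s hW hV hs hB h1
    obtain ⟨m, s', e, hm, hr, hc, hn⟩ := ih V n σ B s hW hV hs hB h1
    refine ⟨_, _, .seq e (.assign _ _ _), ?_,
      fun i hi => by rw [State.set_reg_ne _ _ (by omega), hr i hi], hc, ?_⟩
    · have h3 := STree.size_ofBool_le (decide (c.Holds Ω n σ))
      have h4 := STree.size_ofBool_le
        (decide ((Expr.reg n).eval s'.reg = Expr.nil.eval s'.reg))
      simp only [Expr.cost, time, Expr.eval, hn, Polynomial.eval_add, Polynomial.eval_ofNat] at *
      omega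
    · rw [State.set_reg_self]
      by_cases hh : c.Holds Ω n σ <;> simp [Expr.eval, hn, Holds, hh]
  | and c d ihc ihd =>
    intro V n σ B s hW hV hs hB h1
    obtain ⟨m, s', e, hm, hr, hc, hn⟩ := ihc V n σ B s hW.1 hV hs hB h1
    have h3 := STree.size_ofBool_le (decide (c.Holds Ω n σ))
    by_cases hh : c.Holds Ω n σ
    · obtain ⟨m', s'', e', hm', hr', hc', hn'⟩ := ihd V n σ B s' hW.2 hV
        (fun i hi => by rw [hr i (hV i hi), hs i hi]) hB h1
      refine ⟨_, _, .seq e (.ite_true (by simp [Expr.eval, hn, hh]) e'), ?_,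
        fun i hi => by rw [hr' i hi, hr i hi], by rw [hc', hc], ?_⟩
      · simp only [Expr.cost, time, hn, Polynomial.eval_add, Polynomial.eval_ofNat] at *
        omega
      · simp [hn', Holds, hh]
    · refine ⟨_, _, .seq e (.ite_false (by simp [Expr.eval, hn, hh]) (.skip _)), ?_,
        hr, hc, ?_⟩
      · simp only [Expr.cost, time, hn, Polynomial.eval_add, Polynomial.eval_ofNat] at *
        omega
      · simp [hn, Holds, hh]
  | oracle e =>
    intro V n σ B s hW hV hs hB h1
    have hev := Expr.eval_congr e fun i hi => hs i (hW i hi)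
    have hcost := Expr.cost_le s.reg B h1 e fun i hi => by
        rw [hs i (hW i hi)]; exact hB i (hW i hi)
    by_cases hh : e.eval s.reg ∈ Ω
    · refine ⟨_, _, .query_yes hh, ?_, fun i hi => State.set_reg_ne _ _ (by omega), rfl, ?_⟩
      · simp [time]; omega
      · rw [hev] at hh; simp [Holds, hh]
    · refine ⟨_, _, .query_no hh, ?_, fun i hi => State.set_reg_ne _ _ (by omega), rfl, ?_⟩
      · simp [time]; omega
      · rw [hev] at hh; simp [Holds, hh]
  | all2 a b c ih =>
    intro V n σ B s hW hV hs hB h1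
    obtain ⟨hWa, hWb, hWc⟩ := hW
    -- `L` bounds both lists, hence all their members, and also the old registers, so it is a
    -- legitimate size bound for the body; this is the composition in `time`.
    set L := (a.factor + b.factor + 1) * B with hL
    have hLa : a.factor * B ≤ L := Nat.mul_le_mul_right _ (by omega)
    have hLb : b.factor * B ≤ L := Nat.mul_le_mul_right _ (by omega)
    have hLB : B ≤ L := Nat.le_mul_of_pos_left _ (by omega)
    set s1 := s.set (n + 3) (a.eval s.reg) with hs1
    set s2 := s1.set (n + 4) (b.eval s1.reg) with hs2
    set s3 := s2.set n (.node .nil .nil) with hs3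
    have hs1V : ∀ i < n, s1.reg i = s.reg i := fun i hi => by
      rw [hs1, State.set_reg_ne _ _ (by omega)]
    have hs3V : ∀ i < n, s3.reg i = s.reg i := fun i hi => by
      rw [hs3, State.set_reg_ne _ _ (by omega), hs2, State.set_reg_ne _ _ (by omega), hs1V i hi]
    have hea : a.eval s.reg = a.eval σ := Expr.eval_congr a fun i hi => hs i (hWa i hi)
    have heb : b.eval s1.reg = b.eval σ := Expr.eval_congr b fun i hi => by
      rw [hs1V i (hV i (hWb i hi)), hs i (hWb i hi)]
    have hca := Expr.cost_le s.reg B h1 a fun i hi => by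
      rw [hs i (hWa i hi)]; exact hB i (hWa i hi)
    have hcb := Expr.cost_le s1.reg B h1 b fun i hi => by
      rw [hs1V i (hV i (hWb i hi)), hs i (hWb i hi)]; exact hB i (hWb i hi)
    have hsa := Expr.size_eval_le_cost s.reg a
    have hsb := Expr.size_eval_le_cost s1.reg b
    obtain ⟨m, s4, e4, hm, hr4, hc4, hz4, ⟨bb, hb4⟩, hi4⟩ := exec_loop Ω n (c.compile (n + 5)) s3
      (fun t u => c.Holds Ω (n + 5)
        (Function.update (Function.update σ (n + 1) t) (n + 2) u)) L (c.time.eval L)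
      (by
        intro s' hs' hl1 hl2
        obtain ⟨m, s'', e, h⟩ := ih ((n + 1) :: (n + 2) :: V) (n + 5)
          (Function.update (Function.update σ (n + 1) (s'.reg (n + 1))) (n + 2) (s'.reg (n + 2)))
          L s' hWc
          (by
            simp only [List.mem_cons]
            rintro i (rfl | rfl | hi)
            · omega
            · omega
            · exact lt_of_lt_of_le (hV i hi) (by omega))
          (by
            simp only [List.mem_cons]
            rintro i (rfl | rfl | hi)
            · simp
            · simp
            · have := hV i hi
              rw [Function.update_of_ne (by omega), Function.update_of_ne (by omega), hs' i this,
                hs3V i this, hs i hi])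
          (by
            simp only [List.mem_cons]
            rintro i (rfl | rfl | hi)
            · simpa using hl1
            · simpa using hl2
            · have := hV i hi
              rw [Function.update_of_ne (by omega), Function.update_of_ne (by omega)]
              exact le_trans (hB i hi) hLB)
          (le_trans h1 hLB)
        exact ⟨m, s'', e, h⟩)
      (a.eval σ) (b.eval σ) True s3 (fun _ _ => rfl) rfl
      (by rw [hs3, State.set_reg_ne _ _ (by omega), hs2, State.set_reg_ne _ _ (by omega)]
          simp [hs1, hea])
      (by rw [hs3, State.set_reg_ne _ _ (by omega)]; simp [hs2, heb])
      (by simp [hs3, STree.ofBool]) (hea ▸ by omega) (heb ▸ by omega)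
    have e1 := Exec.assign (Ω := Ω) (n + 3) a s
    have e2 := Exec.assign (Ω := Ω) (n + 4) b s1
    have e3 := Exec.assign (Ω := Ω) n (.cons .nil .nil) s2
    have hsaL : (a.eval σ).size ≤ L := hea ▸ by omega
    have hmm : m ≤ L * (c.time.eval L + 20 * L + 40) := le_trans hm (Nat.mul_le_mul_right _ hsaL)
    have htime : (all2 a b c).time.eval B =
        L * (c.time.eval L + 20 * L + 40) + (20 * L + 40) := by
      simp [time, hL, Polynomial.eval_comp]
    rw [htime]
    by_cases h0 : s4.reg (n + 4) = .nil
    · refine ⟨_, _, .seq e1 (.seq e2 (.seq e3 (.seq e4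
        (.ite_false (by simpa [Expr.eval] using h0) (.skip _))))), ?_,
        fun i hi => by rw [hr4 i hi, hs3V i hi], hc4, ?_⟩
      · simp only [Expr.cost, Expr.eval, STree.size]
        omega
      · rw [hb4] at hi4 ⊢
        simp only [h0, true_and, ne_eq, STree.ofBool_eq_nil, Bool.not_eq_false] at hi4
        congr 1
        rw [Bool.eq_iff_iff, hi4, decide_eq_true_iff]
        rfl
    · refine ⟨_, _, .seq e1 (.seq e2 (.seq e3 (.seq e4
        (.ite_true (by simpa [Expr.eval] using h0) (.assign _ _ _))))), ?_,
        fun i hi => by rw [State.set_reg_ne _ _ (by omega), hr4 i hi, hs3V i hi], hc4, ?_⟩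
      · simp only [Expr.cost, Expr.eval, STree.size]
        omega
      · simp only [h0, false_and, true_and, false_iff] at hi4
        rw [State.set_reg_self]
        simp [Holds, hi4, Expr.eval, STree.ofBool]

end Chk
-- The coins belong to the state, so a branch has only one outcome. An arbitrary accepting run can
-- thus be identified with the run that has been analysed.
theorem Exec.deterministic {Ω : Set STree} {c : Prog} {s s₁ s₂ : State} {m n : ℕ}
    (h₁ : Exec Ω c s m s₁) (h₂ : Exec Ω c s n s₂) : s₁ = s₂ := by
  induction h₁ generalizing n s₂ with
  | skip | assign | choose => cases h₂; rfl
  | seq _ _ ih₁ ih₂ =>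
    cases h₂ with
    | seq a b => cases ih₁ a; exact ih₂ b
  | ite_true h _ ih =>
    cases h₂ with
    | ite_true _ a => exact ih a
    | ite_false h' _ => exact absurd h' h
  | ite_false h _ ih =>
    cases h₂ with
    | ite_true h' _ => exact absurd h h'
    | ite_false _ a => exact ih a
  | loop_done h =>
    cases h₂ with
    | loop_done _ => rfl
    | loop_step h' _ _ => exact absurd h h'
  | loop_step h _ _ ih₁ ih₂ =>
    cases h₂ with
    | loop_done h' => exact absurd h' h
    | loop_step _ a b => cases ih₁ a; exact ih₂ b
  | query_yes h =>
    cases h₂ with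
    | query_yes _ => rfl
    | query_no h' => exact absurd h h'
  | query_no h =>
    cases h₂ with
    | query_yes h' => exact absurd h' h
    | query_no _ => rfl

/-! ## Polynomially bounded functions -/

/-- `f` is bounded by a polynomial. -/
def PolyBounded (f : ℕ → ℕ) : Prop := ∃ p : Polynomial ℕ, ∀ x, f x ≤ p.eval x

namespace PolyBounded

theorem const (k : ℕ) : PolyBounded fun _ => k := ⟨.C k, fun x => by simp⟩

theorem id : PolyBounded fun x => x := ⟨.X, fun x => by simp⟩

theorem add {f g : ℕ → ℕ} : PolyBounded f → PolyBounded g → PolyBounded fun x => f x + g x := by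
  rintro ⟨p, hp⟩ ⟨q, hq⟩
  exact ⟨p + q, fun x => by simpa using add_le_add (hp x) (hq x)⟩

theorem mul {f g : ℕ → ℕ} : PolyBounded f → PolyBounded g → PolyBounded fun x => f x * g x := by
  rintro ⟨p, hp⟩ ⟨q, hq⟩
  exact ⟨p * q, fun x => by simpa using Nat.mul_le_mul (hp x) (hq x)⟩

theorem eval_comp (p : Polynomial ℕ) {f : ℕ → ℕ} : PolyBounded f →
    PolyBounded fun x => p.eval (f x) := by
  rintro ⟨q, hq⟩
  exact ⟨p.comp q, fun x => by simpa [Polynomial.eval_comp] using eval_polynomial_mono p (hq x)⟩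

end PolyBounded

/-! ## Traversal of a tree -/

/-- Executes `body` once for each node of the trees in the list in register `w`. -/
def traverse (w : ℕ) (body : Prog) : Prog :=
  .loop (.reg w) <| .seq body <|
    .ite (.hd (.reg w))
      (.assign w (.cons (.hd (.hd (.reg w))) (.cons (.tl (.hd (.reg w))) (.tl (.reg w)))))
      (.assign w (.tl (.reg w)))

/-- Each round lowers the weight of the work list by exactly one: a leaf is dropped, or an inner
node is replaced by its two children. So a tree is a unary counter for its size, and the work list
never grows beyond `L`. -/
theorem exec_traverse (Ω : Set STree) (w : ℕ) (body : Prog) (N T L : ℕ)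
    (Inv : ℕ → State → Prop) (hset : ∀ k s t, Inv k s → Inv k (s.set w t))
    (hbody : ∀ k s, k < N → Inv k s → ∃ m s', Exec Ω body s m s' ∧ m ≤ T ∧
      s'.reg w = s.reg w ∧ Inv (k + 1) s') (j : ℕ) :
    ∀ k s, (s.reg w).weight = j → k + j = N → (s.reg w).size ≤ L → Inv k s →
      ∃ m s', Exec Ω (traverse w body) s m s' ∧ m ≤ j * (T + 20 * L + 20) + (L + 1) ∧
        Inv N s' := by
  induction j with
  | zero =>
    intro k s hw hk hL hI
    have h0 : s.reg w = .nil := by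
      cases h : s.reg w with
      | nil => rfl
      | node a b => have := a.size_pos; simp [h, STree.weight] at hw; omega
    refine ⟨_, s, .loop_done (by simpa [Expr.eval] using h0), ?_, ?_⟩
    · simp [Expr.cost]; omega
    · obtain rfl : k = N := by omega
      exact hI
  | succ j ih =>
    intro k s hw hk hL hI
    obtain ⟨m, s1, e1, hm, hr1, hI1⟩ := hbody k s (by omega) hI
    cases h : s.reg w with
    | nil => simp [h, STree.weight] at hw
    | node t r =>
      rw [h] at hw hL hr1
      cases t with
      | nil =>
        simp only [STree.weight, STree.size] at hw hL
        obtain ⟨m2, s2, e2, hm2, hI2⟩ := ih (k + 1) (s1.set w r) (by simp; omega) (by omega)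
          (by simp; omega) (hset _ _ _ hI1)
        refine ⟨_, s2, .loop_step (by simp [Expr.eval, h]) (.seq e1 (.ite_false
          (by simp [Expr.eval, hr1, STree.hd]) (.assign _ _ _))) (by
            simp only [Expr.eval, hr1, STree.tl]; exact e2), ?_, hI2⟩
        simp only [Expr.cost, Expr.eval, h, hr1, STree.size, STree.hd, STree.tl]
        rw [Nat.succ_mul]
        omega
      | node a b =>
        simp only [STree.weight, STree.size] at hw hL
        obtain ⟨m2, s2, e2, hm2, hI2⟩ := ih (k + 1) (s1.set w (.node a (.node b r)))
          (by simp [STree.weight]; omega) (by omega)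
          (by simp [STree.size]; omega) (hset _ _ _ hI1)
        refine ⟨_, s2, .loop_step (by simp [Expr.eval, h]) (.seq e1 (.ite_true
          (by simp [Expr.eval, hr1, STree.hd]) (.assign _ _ _))) (by
            simp only [Expr.eval, hr1, STree.tl, STree.hd]; exact e2), ?_, hI2⟩
        simp only [Expr.cost, Expr.eval, h, hr1, STree.size, STree.hd, STree.tl]
        rw [Nat.succ_mul]
        omega

/-! ## Clocks -/

/-- Multiplies the size of register `3` by that of register `0` (roughly). -/
def growClock : Prog :=
  .seq (.assign 2 (.cons (.reg 3) .nil)) <| .seq (.assign 4 .nil) <|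
    .seq (traverse 2 (.assign 4 (.cons (.reg 0) (.reg 4)))) (.assign 3 (.reg 4))

/-- For each node of the old clock one copy of the input is consed onto a list that starts as `nil`:
every copy contributes `x.size + 1`, and the final `nil` contributes 1. -/
theorem exec_growClock (Ω : Set STree) (x : STree) (s : State) (hs : s.reg 0 = x) :
    ∃ m s', Exec Ω growClock s m s' ∧
      m ≤ (s.reg 3).size * (2 * ((s.reg 3).size * (x.size + 1) + 1) + 2 * x.size + 2 +
        20 * ((s.reg 3).size + 2) + 20) + 5 * (s.reg 3).size +
        ((s.reg 3).size * (x.size + 1) + 1) + 20 ∧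
      s'.reg 0 = x ∧ s'.coins = s.coins ∧
      (s'.reg 3).size = (s.reg 3).size * (x.size + 1) + 1 := by
  set N := (s.reg 3).size with hN
  have e1 := Exec.assign (Ω := Ω) 2 (.cons (.reg 3) .nil) s
  set s1 := s.set 2 (Expr.eval s.reg (.cons (.reg 3) .nil)) with hs1
  have e2 := Exec.assign (Ω := Ω) 4 .nil s1
  set s2 := s1.set 4 (Expr.eval s1.reg .nil) with hs2
  obtain ⟨m, s3, e3, hm, h0, hc, h4⟩ := exec_traverse Ω 2 (.assign 4 (.cons (.reg 0) (.reg 4))) N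
    (2 * (N * (x.size + 1) + 1) + 2 * x.size + 2) (N + 2)
    (fun k s' => s'.reg 0 = x ∧ s'.coins = s.coins ∧ (s'.reg 4).size = k * (x.size + 1) + 1)
    (fun k s' t h => by simpa [State.set] using h)
    (by
      rintro k s' hk ⟨h0, hc, h4⟩
      refine ⟨_, _, .assign _ _ _, ?_, by simp [State.set], by simp [State.set, h0], hc, ?_⟩
      · simp only [Expr.cost, Expr.eval, STree.size, h0, h4]
        have : k * (x.size + 1) + (x.size + 1) ≤ N * (x.size + 1) := by
          rw [← Nat.succ_mul]; exact Nat.mul_le_mul_right _ hk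
        omega
      · simp only [Expr.eval, State.set_reg_self, STree.size, h0, h4]
        ring)
    N 0 s2 (by simp [hs2, hs1, State.set, Expr.eval, STree.weight, hN]) (by omega)
    (by simp [hs2, hs1, State.set, Expr.eval, STree.size, hN]; omega)
    (by simp [hs2, hs1, State.set, Expr.eval, STree.size, hs])
  refine ⟨_, _, .seq e1 (.seq e2 (.seq e3 (.assign _ _ _))), ?_, by simp [State.set, h0],
    by simp [hc], by simp [Expr.eval, h4]⟩
  simp only [Expr.cost, Expr.eval, STree.size, h4, ← hN]
  omega

/-- The size of the clock after `k` multiplications, if register `0` has size `n`. -/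
def clockSize (n : ℕ) : ℕ → ℕ
  | 0 => n
  | k + 1 => clockSize n k * (n + 1) + 1

theorem pow_le_clockSize (n k : ℕ) : n ^ (k + 1) ≤ clockSize n k := by
  induction k with
  | zero => simp [clockSize]
  | succ k ih => rw [pow_succ, clockSize]; nlinarith

theorem clockSize_polyBounded (k : ℕ) : PolyBounded fun n => clockSize n k := by
  induction k with
  | zero => exact .id
  | succ k ih => exact (ih.mul (.add .id (.const 1))).add (.const 1)

/-- Puts a tree of size `clockSize n k` into register `3`, if register `0` has size `n`. -/
def clock : ℕ → Prog
  | 0 => .assign 3 (.reg 0)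
  | k + 1 => .seq (clock k) growClock

theorem exec_clock (Ω : Set STree) (k : ℕ) : ∃ f, PolyBounded f ∧ ∀ (x : STree) (s : State),
    s.reg 0 = x → ∃ m s', Exec Ω (clock k) s m s' ∧ m ≤ f x.size ∧ s'.reg 0 = x ∧
      s'.coins = s.coins ∧ (s'.reg 3).size = clockSize x.size k := by
  induction k with
  | zero =>
    refine ⟨fun n => 1 + n, .add (.const 1) .id, fun x s hs => ⟨_, _, .assign _ _ _, ?_, ?_, rfl, ?_⟩⟩
    · simp [Expr.cost, hs]
    · simp [State.set, hs]
    · simp [Expr.eval, hs, clockSize]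
  | succ k ih =>
    obtain ⟨f, hf, h⟩ := ih
    have hN := clockSize_polyBounded k
    have hM := clockSize_polyBounded (k + 1)
    refine ⟨fun n => 1 + f n + (clockSize n k * (2 * clockSize n (k + 1) + 2 * n + 2 +
        20 * (clockSize n k + 2) + 20) + 5 * clockSize n k + clockSize n (k + 1) + 20), ?_,
        fun x s hs => ?_⟩
    · exact ((PolyBounded.const 1).add hf).add <| .add (.add (.add (hN.mul <|
        .add (.add (.add (.add (.mul (.const 2) hM) (.mul (.const 2) .id)) (.const 2))
          (.mul (.const 20) (hN.add (.const 2)))) (.const 20)) (.mul (.const 5) hN)) hM) (.const 20)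
    · obtain ⟨m, s1, e1, hm, h0, hc, h3⟩ := h x s hs
      obtain ⟨m', s2, e2, hm', h0', hc', h3'⟩ := exec_growClock Ω x s1 h0
      rw [h3] at hm' h3'
      exact ⟨_, s2, .seq e1 e2, add_le_add (add_le_add le_rfl hm) hm', h0', hc'.trans hc, h3'⟩

/-! ## Guessing a tree -/

/-- One step of building a tree on a stack: push a leaf, or join the two topmost trees. -/
def pushStep (b : Bool) (G : STree) : STree :=
  if b then .node .nil G else .node (.node G.tl.hd G.hd) G.tl.tl

/-- The stack after `k` steps. -/
def stack (ρ : ℕ → Bool) : ℕ → STree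
  | 0 => .nil
  | k + 1 => pushStep (ρ k) (stack ρ k)

/-- The increase 4 occurs when joining on the empty stack, where both missing operands default to
`nil`. -/
theorem size_pushStep_le (b : Bool) (G : STree) : (pushStep b G).size ≤ G.size + 4 := by
  rcases G with _ | ⟨a, _ | ⟨c, d⟩⟩ <;> cases b <;>
    simp [pushStep, STree.size, STree.hd, STree.tl] <;> omega

theorem size_stack_le (ρ : ℕ → Bool) (k : ℕ) : (stack ρ k).size ≤ 4 * k + 1 := by
  induction k with
  | zero => simp [stack, STree.size]
  | succ k ih => have := size_pushStep_le (ρ k) (stack ρ k); simp only [stack]; omega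

/-- The coins are a postfix code of the tree, one coin per node: the codes of the left and the right
subtree, then a join. -/
theorem exists_foldl_pushStep (t : STree) : ∃ l : List Bool, l.length = t.size ∧
    ∀ G, l.foldl (fun G b => pushStep b G) G = .node t G := by
  induction t with
  | nil => exact ⟨[true], rfl, fun G => by simp [pushStep]⟩
  | node a b iha ihb =>
    obtain ⟨la, ha, ha'⟩ := iha
    obtain ⟨lb, hb, hb'⟩ := ihb
    refine ⟨la ++ lb ++ [false], by simp [STree.size, ha, hb]; omega, fun G => ?_⟩
    rw [List.foldl_append, List.foldl_append, ha', hb']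
    rfl

theorem stack_getD (l : List Bool) :
    stack (fun i => l.getD i true) l.length = l.foldl (fun G b => pushStep b G) .nil := by
  have key : ∀ (ρ : ℕ → Bool) k, stack ρ k =
      ((List.range k).map ρ).foldl (fun G b => pushStep b G) .nil := by
    intro ρ k
    induction k with
    | zero => rfl
    | succ k ih => simp [List.range_succ, stack, ih]
  rw [key]
  congr 1
  apply List.ext_getElem <;> simp +contextual

theorem exists_stack_hd (t : STree) (N : ℕ) (h : t.size ≤ N) : ∃ ρ, (stack ρ N).hd = t := by
  obtain ⟨l, hl, hl'⟩ := exists_foldl_pushStep t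
  obtain ⟨M, rfl⟩ := Nat.exists_eq_add_of_le' h
  -- The number of rounds is fixed at N, so the code is padded in front: the superfluous leaves lie
  -- below the guessed tree on the stack.
  refine ⟨fun i => (List.replicate M true ++ l).getD i true, ?_⟩
  have := stack_getD (List.replicate M true ++ l)
  rw [List.length_append, List.length_replicate, hl] at this
  rw [this, List.foldl_append, hl']
  rfl

/-- Joins the two topmost trees of the stack in register `1`. -/
def joinExpr : Expr :=
  .cons (.cons (.hd (.tl (.reg 1))) (.hd (.reg 1))) (.tl (.tl (.reg 1)))

/-- Guesses a tree, of size at most that of register `3`, and puts it into register `1`. -/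
def guess : Prog :=
  .seq (.assign 2 (.cons (.reg 3) .nil)) <| .seq (.assign 1 .nil) <|
    .seq (traverse 2 (.seq (.choose 5)
      (.ite (.reg 5) (.assign 1 (.cons .nil (.reg 1))) (.assign 1 joinExpr))))
    (.assign 1 (.hd (.reg 1)))

theorem exec_guess (Ω : Set STree) (x : STree) (N : ℕ) (s : State) (hs : s.reg 0 = x)
    (hN : (s.reg 3).size = N) : ∃ m s', Exec Ω guess s m s' ∧
      m ≤ N * ((10 + 50 * (4 * N + 1)) + 20 * (N + 2) + 20) + 20 * N + 30 ∧
      s'.reg 0 = x ∧ s'.reg 1 = (stack s.coins N).hd := by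
  have e1 := Exec.assign (Ω := Ω) 2 (.cons (.reg 3) .nil) s
  set s1 := s.set 2 (Expr.eval s.reg (.cons (.reg 3) .nil)) with hs1
  have e2 := Exec.assign (Ω := Ω) 1 .nil s1
  set s2 := s1.set 1 (Expr.eval s1.reg .nil) with hs2
  obtain ⟨m, s3, e3, hm, h0, h1, hc⟩ := exec_traverse Ω 2 (.seq (.choose 5)
      (.ite (.reg 5) (.assign 1 (.cons .nil (.reg 1))) (.assign 1 joinExpr))) N
    (10 + 50 * (4 * N + 1)) (N + 2)
    (fun k s' => s'.reg 0 = x ∧ s'.reg 1 = stack s.coins k ∧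
      s'.coins = fun i => s.coins (k + i))
    (fun k s' t h => by simpa [State.set] using h)
    (by
      rintro k s' hk ⟨h0, h1, hc⟩
      have hG := size_stack_le s.coins k
      have hG' : (stack s.coins k).size ≤ 4 * N + 1 := by omega
      have hc0 : s'.coins 0 = s.coins k := by simp [hc]
      have e := Exec.choose (Ω := Ω) 5 s'
      set s4 : State := { reg := Function.update s'.reg 5 (STree.ofBool (s'.coins 0))
                          coins := fun k => s'.coins (k + 1) } with hs4
      have h41 : s4.reg 1 = stack s.coins k := by simp [hs4, h1]
      have h45 : s4.reg 5 = STree.ofBool (s.coins k) := by simp [hs4, hc0]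
      have hcc : s4.coins = fun i => s.coins (k + 1 + i) := by
        funext i; simp only [hs4, hc]; congr 1; omega
      have key : ∀ e : Expr, e.reads ⊆ [1] → e.factor ≤ 50 → e.cost s4.reg ≤ 50 * (4 * N + 1) := by
        intro e hr hf
        refine le_trans (Expr.cost_le s4.reg (4 * N + 1) (by omega) e fun i hi => ?_)
          (Nat.mul_le_mul_right _ hf)
        have := hr hi
        simp only [List.mem_singleton] at this
        rw [this, h41]; exact hG'
      cases hb : s.coins k with
      | false =>
        refine ⟨_, _, .seq e (.ite_false (by simp [Expr.eval, h45, hb]) (.assign _ _ _)), ?_,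
          by simp [State.set, hs4], by simp [State.set, hs4, h0], ?_, hcc⟩
        · have := key joinExpr (by simp [joinExpr, Expr.reads])
            (by simp [joinExpr, Expr.factor])
          simp only [Expr.cost, h45, hb, STree.ofBool, STree.size] at *
          omega
        · simp [joinExpr, Expr.eval, h41, stack, pushStep, hb]
      | true =>
        refine ⟨_, _, .seq e (.ite_true (by simp [Expr.eval, h45, hb]) (.assign _ _ _)), ?_,
          by simp [State.set, hs4], by simp [State.set, hs4, h0], ?_, hcc⟩
        · have := key (.cons .nil (.reg 1)) (by simp [Expr.reads]) (by simp [Expr.factor])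
          simp only [Expr.cost, h45, hb, STree.ofBool, STree.size] at *
          omega
        · simp [Expr.eval, h41, stack, pushStep, hb])
    N 0 s2 (by simp [hs2, hs1, State.set, Expr.eval, STree.weight, hN]) (by omega)
    (by simp [hs2, hs1, State.set, Expr.eval, STree.size, hN]; omega)
    (by simp [hs2, hs1, State.set, Expr.eval, hs, stack])
  refine ⟨_, _, .seq e1 (.seq e2 (.seq e3 (.assign _ _ _))), ?_, by simp [State.set, h0],
    by simp [Expr.eval, h1]⟩
  have hG := size_stack_le s.coins N
  have hG2 := STree.size_hd_le (stack s.coins N)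
  simp only [Expr.cost, Expr.eval, STree.size, h1, hN]
  omega

/-! ## Nondeterministic algorithms by guess and check -/

/-- A problem is in NP with an oracle if a solution of polynomial size can be verified by a check. -/
theorem inNPOracle_of_check {α β : Type} [TreeEncoding α] [TreeEncoding β] (P : α → Prop)
    (O : β → Prop) (c : Chk) (k : ℕ) (hc : c.Closed [0, 1] 2)
    (sound : ∀ (x : α) (σ : ℕ → STree), σ 0 = TreeEncoding.enc x →
      c.Holds (TreeEncoding.enc '' {y | O y}) 2 σ → P x)
    (complete : ∀ x : α, P x → ∃ g : STree, g.size ≤ (TreeEncoding.enc x).size ^ (k + 1) ∧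
      ∀ σ : ℕ → STree, σ 0 = TreeEncoding.enc x → σ 1 = g →
        c.Holds (TreeEncoding.enc '' {y | O y}) 2 σ) :
    InNPOracle P O := by
  classical
  set Ω : Set STree := TreeEncoding.enc '' {y | O y} with hΩ
  obtain ⟨f, hf, hclock⟩ := exec_clock Ω k
  have hN := clockSize_polyBounded k
  let F : ℕ → ℕ := fun n => f n +
    (clockSize n k * ((10 + 50 * (4 * clockSize n k + 1)) + 20 * (clockSize n k + 2) + 20) +
      20 * clockSize n k + 30) + c.time.eval (n + (4 * clockSize n k + 1)) + 10
  have hF : PolyBounded F := by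
    have h4 := ((PolyBounded.const 4).mul hN).add (.const 1)
    exact ((hf.add <| .add (.add (hN.mul <| .add (.add (.add (.const 10) (.mul (.const 50) h4))
      (.mul (.const 20) (hN.add (.const 2)))) (.const 20)) (.mul (.const 20) hN)) (.const 30)).add
      (.eval_comp _ (.add .id h4))).add (.const 10)
  obtain ⟨p, hp⟩ := hF
  -- Every branch is analysed once: it halts in time, and it accepts iff the check holds for the
  -- tree coded by its coins.
  have main : ∀ (x : α) (ρ : ℕ → Bool), ∃ n s, Exec Ω (.seq (clock k) (.seq guess
      (.seq (c.compile 2) (.assign 0 (.reg 2))))) (initState (TreeEncoding.enc x) ρ) n s ∧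
      n ≤ F (TreeEncoding.enc x).size ∧ ∃ σ : ℕ → STree, σ 0 = TreeEncoding.enc x ∧
        σ 1 = (stack ρ (clockSize (TreeEncoding.enc x).size k)).hd ∧
        (s.reg 0 ≠ .nil ↔ c.Holds Ω 2 σ) := by
    intro x ρ
    set X := TreeEncoding.enc x with hX
    obtain ⟨m1, s1, e1, hm1, h10, h1c, h13⟩ := hclock X (initState X ρ) rfl
    obtain ⟨m2, s2, e2, hm2, h20, h21⟩ := exec_guess Ω X _ s1 h10 h13
    have hρ : s1.coins = ρ := h1c
    rw [hρ] at h21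
    have hsz := le_trans (STree.size_hd_le _) (size_stack_le ρ (clockSize X.size k))
    obtain ⟨m3, s3, e3, hm3, -, -, h32⟩ := Chk.exec_compile Ω c [0, 1] 2 s2.reg
      (X.size + (4 * clockSize X.size k + 1)) s2 hc (by simp) (by simp)
      (by
        simp only [List.mem_cons, List.not_mem_nil, or_false]
        rintro i (rfl | rfl)
        · rw [h20]; omega
        · rw [h21]; omega) (by omega)
    refine ⟨_, _, .seq e1 (.seq e2 (.seq e3 (.assign _ _ _))), ?_, s2.reg, h20, h21, ?_⟩
    · have h3 := STree.size_ofBool_le (decide (c.Holds Ω 2 s2.reg))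
      simp only [Expr.cost, h32, F]
      omega
    · simp [Expr.eval, h32]
  refine ⟨.seq (clock k) (.seq guess (.seq (c.compile 2) (.assign 0 (.reg 2)))), p,
    fun x => ⟨fun ρ => ?_, fun hx => ?_, ?_⟩⟩
  · obtain ⟨n, s, e, hn, -⟩ := main x ρ
    exact ⟨n, s, e, hn.trans (hp _)⟩
  · obtain ⟨g, hg, hh⟩ := complete x hx
    obtain ⟨ρ, hρ⟩ := exists_stack_hd g _ (hg.trans (pow_le_clockSize _ k))
    obtain ⟨n, s, e, -, σ, h0, h1, hs⟩ := main x ρ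
    exact ⟨ρ, n, s, e, hs.2 (hh σ h0 (h1.trans hρ))⟩
  · rintro ⟨ρ, n, s, e, hs⟩
    obtain ⟨n', s', e', -, σ, h0, -, hs'⟩ := main x ρ
    exact sound x σ h0 (hs'.1 (e'.deterministic e ▸ hs))

/-! ## Active domains and well-formed accesses -/

section Basics

variable {dom : Name → Set Name} {S : Schema}

theorem Schema.Valid.unique (hS : S.Valid) {r : Name} {ds ds' : List Name}
    (h : (r, ds) ∈ S.rels) (h' : (r, ds') ∈ S.rels) : ds = ds' :=
  congrArg Prod.snd (List.inj_on_of_nodup_map hS.1 h h' rfl)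

theorem adom_mono {C D : Finset Fact} (h : C ⊆ D) : adom S C ⊆ adom S D := by
  rintro cd ⟨f, hf, ds, h1, h2⟩
  exact ⟨f, h hf, ds, h1, h2⟩

theorem adom_union (C D : Finset Fact) : adom S (C ∪ D) = adom S C ∪ adom S D := by
  ext cd
  constructor
  · rintro ⟨f, hf, ds, h1, h2⟩
    rcases Finset.mem_union.1 hf with hf | hf
    · exact .inl ⟨f, hf, ds, h1, h2⟩
    · exact .inr ⟨f, hf, ds, h1, h2⟩
  · rintro (h | h)
    · exact adom_mono Finset.subset_union_left h
    · exact adom_mono Finset.subset_union_right h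

theorem IsInstance.mono {I J : Finset Fact} (h : IsInstance dom S J) (hIJ : I ⊆ J) :
    IsInstance dom S I := fun f hf => h f (hIJ hf)

theorem IsInstance.union {I J : Finset Fact} (hI : IsInstance dom S I) (hJ : IsInstance dom S J) :
    IsInstance dom S (I ∪ J) := fun f hf => (Finset.mem_union.1 hf).elim (hI f) (hJ f)

theorem isInstance_singleton {f : Fact} : IsInstance dom S {f} ↔ WellTyped dom S f := by
  simp [IsInstance]

theorem WellTyped.forall₂ (hS : S.Valid) {f : Fact} (hf : WellTyped dom S f) {ds : List Name}
    (h : (f.1, ds) ∈ S.rels) : List.Forall₂ (fun c d => c ∈ dom d) f.2 ds := by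
  obtain ⟨ds', h1, h2⟩ := hf
  rwa [hS.unique h h1]

theorem mem_dom_of_mem_adom (hS : S.Valid) {C : Finset Fact} (hC : IsInstance dom S C) {c d : Name}
    (h : (c, d) ∈ adom S C) : c ∈ dom d := by
  obtain ⟨f, hf, ds, h1, h2⟩ := h
  exact (List.forall₂_iff_zip.1 ((hC f hf).forall₂ hS h1)).2 h2

theorem Access.WellFormed.mono {C D : Finset Fact} {a : Access} (h : a.WellFormed dom S C)
    (hCD : C ⊆ D) : a.WellFormed dom S D := by
  obtain ⟨h1, h2, ds, h3, h4⟩ := h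
  exact ⟨h1, h2, ds, h3, fun c d hcd => ⟨(h4 c d hcd).1, fun hd => adom_mono hCD ((h4 c d hcd).2 hd)⟩⟩

/-! ## Paths -/

theorem endConf_append (C : Finset Fact) (p q : List AccessStep) :
    endConf C (p ++ q) = endConf (endConf C p) q := by
  induction p generalizing C with
  | nil => rfl
  | cons s p ih => exact ih _

/-- A path only adds its responses, so extra initial facts can be split off at the end. In this way
F is removed from a configuration while it still enables the accesses of the path. -/
theorem endConf_union (C D : Finset Fact) (p : List AccessStep) :
    endConf (C ∪ D) p = endConf C p ∪ D := by
  induction p generalizing C with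
  | nil => rfl
  | cons s p ih => rw [endConf, endConf, Finset.union_right_comm, ih]

theorem subset_endConf (C : Finset Fact) (p : List AccessStep) : C ⊆ endConf C p := by
  have := endConf_union C C p
  rw [Finset.union_idempotent] at this
  rw [this]
  exact Finset.subset_union_right

theorem endConf_mono {C D : Finset Fact} (h : C ⊆ D) (p : List AccessStep) :
    endConf C p ⊆ endConf D p := by
  rw [← Finset.union_eq_right.2 h, endConf_union]
  exact Finset.subset_union_left

theorem IsPath.mono {I J C D : Finset Fact} {p : List AccessStep} (h : IsPath dom S I C p)
    (hIJ : I ⊆ J) (hCD : C ⊆ D) : IsPath dom S J D p := by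
  induction p generalizing C D with
  | nil => trivial
  | cons s p ih =>
    exact ⟨⟨h.1.1.mono hCD, fun f hf => ⟨hIJ (h.1.2 f hf).1, (h.1.2 f hf).2⟩⟩,
      ih h.2 (Finset.union_subset_union_left hCD)⟩

theorem isPath_append {I C : Finset Fact} {p q : List AccessStep} :
    IsPath dom S I C (p ++ q) ↔ IsPath dom S I C p ∧ IsPath dom S I (endConf C p) q := by
  induction p generalizing C with
  | nil => simp [IsPath, endConf]
  | cons s p ih => simp [IsPath, endConf, ih, and_assoc]

theorem IsPath.endConf_subset {I C : Finset Fact} {p : List AccessStep} (h : IsPath dom S I C p)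
    (hC : C ⊆ I) : endConf C p ⊆ I := by
  induction p generalizing C with
  | nil => exact hC
  | cons s p ih => exact ih h.2 (Finset.union_subset hC fun f hf => (h.1.2 f hf).1)

theorem endConf_wellFormedPrefix_subset (C : Finset Fact) (p : List AccessStep) :
    endConf C (wellFormedPrefix dom S C p) ⊆ endConf C p := by
  induction p generalizing C with
  | nil => exact subset_rfl
  | cons s p ih =>
    rw [wellFormedPrefix]
    split_ifs
    · exact ih _
    · exact subset_endConf _ _

theorem IsPath.wellFormedPrefix_append {I C : Finset Fact} {p : List AccessStep}
    (h : IsPath dom S I C p) (q : List AccessStep) :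
    wellFormedPrefix dom S C (p ++ q) = p ++ wellFormedPrefix dom S (endConf C p) q := by
  induction p generalizing C with
  | nil => rfl
  | cons s p ih => rw [List.cons_append, wellFormedPrefix, if_pos h.1.1, ih h.2]; rfl

theorem IsPath.wellFormedPrefix_eq {I C : Finset Fact} {p : List AccessStep}
    (h : IsPath dom S I C p) : wellFormedPrefix dom S C p = p := by
  simpa [wellFormedPrefix] using h.wellFormedPrefix_append []

/-- A truncation that stops inside `p` never sees `q`, so `q` may make the query true without
affecting the truncated path. -/
theorem wellFormedPrefix_append_of_ne {C : Finset Fact} {p : List AccessStep}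
    (h : wellFormedPrefix dom S C p ≠ p) (q : List AccessStep) :
    wellFormedPrefix dom S C (p ++ q) = wellFormedPrefix dom S C p := by
  induction p generalizing C with
  | nil => exact absurd rfl h
  | cons s p ih =>
    rw [List.cons_append, wellFormedPrefix, wellFormedPrefix]
    rw [wellFormedPrefix] at h
    split_ifs with hs
    · rw [if_pos hs] at h
      rw [ih fun h' => h (by rw [h'])]
    · rfl

/-- Only well-formedness depends on the current configuration; soundness of the responses refers to
the instance alone. -/
theorem IsPath.of_wellFormedPrefix_eq {I C D : Finset Fact} {p : List AccessStep}
    (h : IsPath dom S I D p) (hp : wellFormedPrefix dom S C p = p) : IsPath dom S I C p := by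
  induction p generalizing C D with
  | nil => trivial
  | cons s p ih =>
    rw [wellFormedPrefix] at hp
    split_ifs at hp with hs
    exact ⟨⟨hs, h.1.2⟩, ih h.2 (List.cons.inj hp).2⟩

theorem exists_split_of_wellFormedPrefix_ne {C : Finset Fact} {p : List AccessStep}
    (h : wellFormedPrefix dom S C p ≠ p) : ∃ s r, p = wellFormedPrefix dom S C p ++ s :: r ∧
      ¬ s.access.WellFormed dom S (endConf C (wellFormedPrefix dom S C p)) := by
  induction p generalizing C with
  | nil => exact absurd rfl h
  | cons s p ih =>
    rw [wellFormedPrefix] at h ⊢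
    split_ifs with hs
    · rw [if_pos hs] at h
      obtain ⟨s', r, h1, h2⟩ := ih fun h' => h (by rw [h'])
      exact ⟨s', r, by rw [List.cons_append, ← h1], h2⟩
    · exact ⟨s, p, rfl, hs⟩

/-! ## Certainty and relevance -/

theorem CQ.Holds.mono {Q : CQ} {C D : Finset Fact} (h : CQ.Holds Q C) (hCD : C ⊆ D) :
    CQ.Holds Q D := by
  obtain ⟨v, hv⟩ := h
  exact ⟨v, fun A hA => hCD (hv A hA)⟩

/-- A configuration is itself the least instance consistent with it, and conjunctive queries are
monotone. -/
theorem CQ.certain_iff_holds {Q : CQ} {C : Finset Fact} (hC : IsInstance dom S C) :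
    CQ.Certain dom S C Q ↔ CQ.Holds Q C :=
  ⟨fun h => h C hC subset_rfl, fun h _ _ hI => h.mono hI⟩

/-- By monotonicity certainty can only get lost under truncation, so one of the two possible
differences remains. Here `q` is the path after the first access, with F as the response. -/
theorem longTermRelevant_iff {C : Finset Fact} {Q : CQ} {a : Access} {F : Fact}
    (ha : a.WellFormed dom S C) (hF : ∀ f, a.Matches f ↔ f = F) :
    LongTermRelevant dom S C Q a ↔ ∃ I q, IsInstance dom S I ∧ C ∪ {F} ⊆ I ∧
      IsPath dom S I (C ∪ {F}) q ∧ CQ.Holds Q (endConf C q ∪ {F}) ∧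
      ¬ CQ.Holds Q (endConf C (wellFormedPrefix dom S C q)) := by
  constructor
  · rintro ⟨I, hI, hCI, p, hp, ⟨s, q, rfl, rfl⟩, hne⟩
    obtain ⟨⟨-, hresp⟩, hq⟩ := hp
    have hsub : s.resp ⊆ {F} := fun f hf => by simpa using (hF f).1 (hresp f hf).2
    have hsubI : endConf C (wellFormedPrefix dom S C q) ⊆ I :=
      (endConf_wellFormedPrefix_subset C q).trans <|
        (endConf_mono Finset.subset_union_left q).trans <|
          hq.endConf_subset (Finset.union_subset hCI fun f hf => (hresp f hf).1)
    -- After an empty response the rest is a path from C already, so nothing is truncated and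
    -- certainty cannot differ.
    rcases Finset.subset_singleton_iff.1 hsub with h0 | h1
    · rw [h0, Finset.union_empty] at hq
      simp [truncatedPath, endConf, h0, hq.wellFormedPrefix_eq] at hne
    · rw [h1] at hq
      have hFI : C ∪ {F} ⊆ I := Finset.union_subset hCI fun f hf => (hresp f (h1 ▸ hf)).1
      have hend : endConf C (s :: q) = endConf C q ∪ {F} := by rw [endConf, h1, endConf_union]
      have hendI : endConf C q ∪ {F} ⊆ I := by
        rw [← endConf_union]; exact hq.endConf_subset hFI
      rw [hend, truncatedPath, List.tail_cons, CQ.certain_iff_holds (hI.mono hendI),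
        CQ.certain_iff_holds (hI.mono hsubI)] at hne
      have : CQ.Holds Q (endConf C (wellFormedPrefix dom S C q)) →
          CQ.Holds Q (endConf C q ∪ {F}) := fun h => h.mono <|
        (endConf_wellFormedPrefix_subset C q).trans Finset.subset_union_left
      exact ⟨I, q, hI, hFI, hq, by tauto, by tauto⟩
  · rintro ⟨I, q, hI, hCI, hq, h1, h2⟩
    have hFI : F ∈ I := hCI (by simp)
    have hCI' : C ⊆ I := Finset.subset_union_left.trans hCI
    refine ⟨I, hI, hCI', ⟨a, {F}⟩ :: q, ⟨⟨ha, fun f hf => ?_⟩, hq⟩, ⟨_, _, rfl, rfl⟩, ?_⟩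
    · rw [Finset.mem_singleton] at hf
      exact ⟨hf ▸ hFI, (hF f).2 hf⟩
    · have hend : endConf C (⟨a, {F}⟩ :: q) = endConf C q ∪ {F} := by rw [endConf, endConf_union]
      have hendI : endConf C q ∪ {F} ⊆ I := by
        rw [← endConf_union]; exact hq.endConf_subset hCI
      rw [hend, truncatedPath, List.tail_cons, CQ.certain_iff_holds (hI.mono hendI),
        CQ.certain_iff_holds (hI.mono <| (endConf_wellFormedPrefix_subset C q).trans <|
          Finset.subset_union_left.trans hendI)]
      tauto

end Basics

/-! ## Adding a relation to a schema -/

/-- The schema with an additional relation, without access methods. -/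
def Schema.extend (S : Schema) (n : Name) (ds : List Name) : Schema := ⟨(n, ds) :: S.rels, S.methods⟩

section Extend

variable {dom : Name → Set Name} {S : Schema} {n : Name} {es : List Name}

theorem ne_of_mem_rels (hn : n ∉ S.rels.map Prod.fst) {r : Name} {ds : List Name}
    (h : (r, ds) ∈ S.rels) : r ≠ n := fun h' => hn (List.mem_map.2 ⟨_, h, h'⟩)

theorem Schema.Valid.extend (hS : S.Valid) (hn : n ∉ S.rels.map Prod.fst) :
    (S.extend n es).Valid := by
  refine ⟨by simpa [Schema.extend] using ⟨by simpa using hn, hS.1⟩, fun m hm => ?_⟩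
  obtain ⟨ds, h1, h2⟩ := hS.2 m hm
  exact ⟨ds, List.mem_cons_of_mem _ h1, h2⟩

theorem Schema.Valid.fresh_of_extend (hS : (S.extend n es).Valid) : n ∉ S.rels.map Prod.fst :=
  (List.nodup_cons.1 hS.1).1

theorem mem_extend_rels_of_ne {r : Name} {ds : List Name} (hr : r ≠ n) :
    (r, ds) ∈ (S.extend n es).rels ↔ (r, ds) ∈ S.rels := by
  simp [Schema.extend, hr]

theorem WellTyped.extend {f : Fact} (h : WellTyped dom S f) : WellTyped dom (S.extend n es) f := by
  obtain ⟨ds, h1, h2⟩ := h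
  exact ⟨ds, List.mem_cons_of_mem _ h1, h2⟩

theorem WellTyped.of_extend {f : Fact} (h : WellTyped dom (S.extend n es) f) (hf : f.1 ≠ n) :
    WellTyped dom S f := by
  obtain ⟨ds, h1, h2⟩ := h
  exact ⟨ds, (mem_extend_rels_of_ne hf).1 h1, h2⟩

theorem IsInstance.extend {C : Finset Fact} (h : IsInstance dom S C) :
    IsInstance dom (S.extend n es) C := fun f hf => (h f hf).extend

theorem IsInstance.rel_ne (hn : n ∉ S.rels.map Prod.fst) {C : Finset Fact}
    (h : IsInstance dom S C) {f : Fact} (hf : f ∈ C) : f.1 ≠ n := by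
  obtain ⟨ds, h1, -⟩ := h f hf
  exact ne_of_mem_rels hn h1

theorem adom_extend (hn : n ∉ S.rels.map Prod.fst) {C : Finset Fact} (h : IsInstance dom S C) :
    adom (S.extend n es) C = adom S C := by
  ext cd
  constructor
  · rintro ⟨f, hf, ds, h1, h2⟩
    exact ⟨f, hf, ds, (mem_extend_rels_of_ne (h.rel_ne hn hf)).1 h1, h2⟩
  · rintro ⟨f, hf, ds, h1, h2⟩
    exact ⟨f, hf, ds, List.mem_cons_of_mem _ h1, h2⟩

theorem adom_singleton (hS : S.Valid) {r : Name} {ds t : List Name} (h : (r, ds) ∈ S.rels) :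
    adom S {(r, t)} = {cd | cd ∈ t.zip ds} := by
  ext cd
  constructor
  · rintro ⟨f, hf, ds', h1, h2⟩
    rw [Finset.mem_singleton] at hf
    subst hf
    rwa [hS.unique h1 h] at h2
  · exact fun h' => ⟨_, Finset.mem_singleton_self _, ds, h, h'⟩

/-- The relations `n` and `r` have the same attribute domains, so it does not matter for the active
domain, and hence for well-formedness, which of them contains `t`. -/
theorem adom_extend_union (hS : S.Valid) (hn : n ∉ S.rels.map Prod.fst) {r : Name} {t : List Name}
    (hr : (r, es) ∈ S.rels) {C : Finset Fact} (hC : IsInstance dom S C) :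
    adom (S.extend n es) (C ∪ {(n, t)}) = adom S (C ∪ {(r, t)}) := by
  rw [adom_union, adom_union, adom_extend hn hC, adom_singleton hS hr,
    adom_singleton (hS.extend hn) List.mem_cons_self]

theorem Access.wellFormed_extend_iff (hS : S.Valid) (hn : n ∉ S.rels.map Prod.fst)
    {C D : Finset Fact} (h : adom (S.extend n es) C = adom S D) {a : Access} :
    a.WellFormed dom (S.extend n es) C ↔ a.WellFormed dom S D := by
  unfold Access.WellFormed
  rw [h]
  refine and_congr_right fun hm => and_congr_right fun _ => exists_congr fun ds =>
    and_congr_left fun _ => mem_extend_rels_of_ne ?_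
  obtain ⟨ds, h1, -⟩ := hS.2 a.method hm
  exact ne_of_mem_rels hn h1

theorem Access.WellFormed.rel_mem {C : Finset Fact} {a : Access} (h : a.WellFormed dom S C) :
    ∃ ds, (a.method.rel, ds) ∈ S.rels := by
  obtain ⟨-, -, ds, h, -⟩ := h
  exact ⟨ds, h⟩

/-- Methods exist only on old relations, so no response contains a fact over `n`, and agreement of
the active domains is preserved along the path. The sets E and E' cover both the copied fact and the
case that nothing is added. -/
theorem IsPath.of_extend (hS : S.Valid) (hn : n ∉ S.rels.map Prod.fst) {E E' I I' : Finset Fact}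
    (hE : ∀ C, IsInstance dom S C → adom (S.extend n es) (C ∪ E') = adom S (C ∪ E))
    (hI' : IsInstance dom (S.extend n es) I') (hII : ∀ f ∈ I', f.1 ≠ n → f ∈ I)
    {p : List AccessStep} {C : Finset Fact} (hC : IsInstance dom S C)
    (h : IsPath dom (S.extend n es) I' (C ∪ E') p) :
    IsPath dom S I (C ∪ E) p ∧ IsInstance dom S (endConf C p) := by
  induction p generalizing C with
  | nil => exact ⟨trivial, hC⟩
  | cons s p ih =>
    have hwf := (Access.wellFormed_extend_iff hS hn (hE C hC)).1 h.1.1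
    obtain ⟨ds, hds⟩ := hwf.rel_mem
    have hne : ∀ f ∈ s.resp, f.1 ≠ n := fun f hf => by
      rw [(h.1.2 f hf).2.1]; exact ne_of_mem_rels hn hds
    have := ih (C := C ∪ s.resp)
      (hC.union fun f hf => (hI' f (h.1.2 f hf).1).of_extend (hne f hf))
      (by rw [Finset.union_right_comm]; exact h.2)
    refine ⟨⟨⟨hwf, fun f hf => ⟨hII f (h.1.2 f hf).1 (hne f hf), (h.1.2 f hf).2⟩⟩, ?_⟩, this.2⟩
    rw [Finset.union_right_comm]
    exact this.1

theorem IsPath.extend (hS : S.Valid) (hn : n ∉ S.rels.map Prod.fst) {E E' I I' : Finset Fact}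
    (hE : ∀ C, IsInstance dom S C → adom (S.extend n es) (C ∪ E') = adom S (C ∪ E))
    (hI : IsInstance dom S I) (hII : I ⊆ I') {p : List AccessStep} {C : Finset Fact}
    (hC : IsInstance dom S C) (h : IsPath dom S I (C ∪ E) p) :
    IsPath dom (S.extend n es) I' (C ∪ E') p := by
  induction p generalizing C with
  | nil => trivial
  | cons s p ih =>
    refine ⟨⟨(Access.wellFormed_extend_iff hS hn (hE C hC)).2 h.1.1,
      fun f hf => ⟨hII (h.1.2 f hf).1, (h.1.2 f hf).2⟩⟩, ?_⟩
    rw [Finset.union_right_comm]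
    apply ih (hC.union fun f hf => hI f (h.1.2 f hf).1)
    rw [Finset.union_right_comm]
    exact h.2

/-- A copy of the fact `(r, t)` in the new relation makes the same configurations reachable as the
fact itself. -/
theorem reachable_extend_iff (hS : S.Valid) (hn : n ∉ S.rels.map Prod.fst) {r : Name}
    {t : List Name} (hr : (r, es) ∈ S.rels) (ht : WellTyped dom S (r, t)) {C C' : Finset Fact}
    (hC : IsInstance dom S C) :
    Reachable dom (S.extend n es) (C ∪ {(n, t)}) C' ↔ ∃ I p, IsInstance dom S I ∧
      C ∪ {(r, t)} ⊆ I ∧ IsPath dom S I (C ∪ {(r, t)}) p ∧ C' = endConf C p ∪ {(n, t)} := by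
  have hE : ∀ C, IsInstance dom S C →
      adom (S.extend n es) (C ∪ {(n, t)}) = adom S (C ∪ {(r, t)}) :=
    fun C hC => adom_extend_union hS hn hr hC
  constructor
  · rintro ⟨I', hI', hCI, p, hp, rfl⟩
    -- The instance is stripped of its facts over `n`, and the original fact is put in.
    refine ⟨I'.filter (·.1 ≠ n) ∪ {(r, t)}, p, ?_, ?_, (hp.of_extend hS hn hE hI' ?_ hC).1,
      endConf_union _ _ _⟩
    · refine IsInstance.union (fun f hf => ?_) (isInstance_singleton.2 ht)
      rw [Finset.mem_filter] at hf
      exact (hI' f hf.1).of_extend hf.2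
    · refine Finset.union_subset_union_left fun f hf => Finset.mem_filter.2 ⟨?_, hC.rel_ne hn hf⟩
      exact hCI (Finset.mem_union_left _ hf)
    · exact fun f hf hf' => Finset.mem_union_left _ (Finset.mem_filter.2 ⟨hf, hf'⟩)
  · rintro ⟨I, p, hI, hCI, hp, rfl⟩
    refine ⟨I ∪ {(n, t)}, hI.extend.union (isInstance_singleton.2
      ⟨es, List.mem_cons_self, ht.forall₂ hS hr⟩), ?_, p,
      hp.extend hS hn hE hI Finset.subset_union_left hC, endConf_union _ _ _⟩
    exact Finset.union_subset_union_left (Finset.subset_union_left.trans hCI)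

/-- A new empty relation does not influence reachability. -/
theorem reachable_extend_iff' (hS : S.Valid) (hn : n ∉ S.rels.map Prod.fst) {C C' : Finset Fact}
    (hC : IsInstance dom S C) : Reachable dom (S.extend n es) C C' ↔ Reachable dom S C C' := by
  have hE : ∀ C, IsInstance dom S C → adom (S.extend n es) (C ∪ ∅) = adom S (C ∪ ∅) :=
    fun C hC => by rw [Finset.union_empty, adom_extend hn hC]
  constructor
  · rintro ⟨I', hI', hCI, p, hp, rfl⟩
    rw [← Finset.union_empty C] at hp
    refine ⟨I'.filter (·.1 ≠ n), fun f hf => ?_, fun f hf =>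
      Finset.mem_filter.2 ⟨hCI hf, hC.rel_ne hn hf⟩, p, ?_, rfl⟩
    · rw [Finset.mem_filter] at hf
      exact (hI' f hf.1).of_extend hf.2
    · simpa using (hp.of_extend hS hn hE hI' (I := I'.filter (·.1 ≠ n))
        (fun f hf hf' => Finset.mem_filter.2 ⟨hf, hf'⟩) hC).1
  · rintro ⟨I, hI, hCI, p, hp, rfl⟩
    rw [← Finset.union_empty C] at hp
    refine ⟨I, hI.extend, hCI, p, ?_, rfl⟩
    simpa using hp.extend hS hn hE hI subset_rfl hC

/-! ### Redirecting atoms of a query to the copied relation -/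

theorem CQ.holds_union_singleton {Q : CQ} {C : Finset Fact} {f : Fact}
    (h : ∀ A ∈ Q, A.rel ≠ f.1) : CQ.Holds Q (C ∪ {f}) ↔ CQ.Holds Q C := by
  refine ⟨?_, fun h => h.mono Finset.subset_union_left⟩
  rintro ⟨v, hv⟩
  refine ⟨v, fun A hA => ?_⟩
  rcases Finset.mem_union.1 (hv A hA) with h' | h'
  · exact h'
  · exact absurd (congrArg Prod.fst (Finset.mem_singleton.1 h')) (h A hA)

/-- The atom `B` is `A`, or `A` is over the relation `r` and `B` is its copy over `n`. -/
def Atom.Redirect (r n : Name) (A B : Atom) : Prop :=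
  B.args = A.args ∧ (B.rel = A.rel ∨ A.rel = r ∧ B.rel = n)

theorem List.Forall₂.exists_of_mem {α β : Type*} {R : α → β → Prop} {l : List α} {l' : List β}
    (h : List.Forall₂ R l l') {a : α} (ha : a ∈ l) : ∃ b ∈ l', R a b := by
  induction h with
  | nil => simp at ha
  | cons h _ ih =>
    rcases List.mem_cons.1 ha with rfl | ha
    · exact ⟨_, List.mem_cons_self, h⟩
    · obtain ⟨b, hb, hR⟩ := ih ha
      exact ⟨b, List.mem_cons_of_mem _ hb, hR⟩

/-- The only fact over `n` is the copy of `(r, t)`, so a redirected atom maps back to that fact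
under the same valuation. -/
theorem CQ.Holds.of_redirect {Q Q' : CQ} {r : Name} {t : List Name} {C : Finset Fact}
    (hQ : List.Forall₂ (Atom.Redirect r n) Q Q') (hC : ∀ f ∈ C, f.1 ≠ n)
    (hQn : ∀ A ∈ Q, A.rel ≠ n)
    (h : CQ.Holds Q' (C ∪ {(n, t)})) : CQ.Holds Q (C ∪ {(r, t)}) := by
  obtain ⟨v, hv⟩ := h
  refine ⟨v, fun A hA => ?_⟩
  obtain ⟨B, hB, hargs, hrel⟩ := List.Forall₂.exists_of_mem hQ hA
  have := hv B hB
  rw [hargs] at this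
  rcases Finset.mem_union.1 this with h' | h'
  · rcases hrel with hrel | ⟨-, hrel⟩
    · rw [hrel] at h'
      exact Finset.mem_union_left _ h'
    · exact absurd hrel (hC _ h')
  · simp only [Finset.mem_singleton, Prod.mk.injEq] at h'
    rcases hrel with hrel | ⟨hr, -⟩
    · exact absurd (hrel.symm.trans h'.1) (hQn A hA)
    · rw [hr, h'.2]
      simp

/-- A satisfying valuation shows which atoms use the fact `(r, t)`; exactly these are redirected. -/
theorem CQ.Holds.exists_redirect {Q : CQ} {r : Name} {t : List Name} {C : Finset Fact}
    (h : CQ.Holds Q (C ∪ {(r, t)})) : ∃ Q' : CQ, List.Forall₂ (Atom.Redirect r n) Q Q' ∧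
      CQ.Holds Q' (C ∪ {(n, t)}) := by
  classical
  obtain ⟨v, hv⟩ := h
  let φ : Atom → Atom := fun A =>
    if (A.rel, A.args.map (Term.eval v)) = (r, t) then ⟨n, A.args⟩ else A
  refine ⟨Q.map φ, ?_, v, ?_⟩
  · rw [List.forall₂_map_right_iff, List.forall₂_same]
    intro A _
    simp only [φ, Atom.Redirect]
    split_ifs with hA
    · exact ⟨rfl, .inr ⟨congrArg Prod.fst hA, rfl⟩⟩
    · exact ⟨rfl, .inl rfl⟩
  · intro B hB
    obtain ⟨A, hA, rfl⟩ := List.mem_map.1 hB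
    simp only [φ]
    split_ifs with h'
    · simp [(Prod.mk.injEq _ _ _ _ ▸ h').2]
    · rcases Finset.mem_union.1 (hv A hA) with h'' | h''
      · exact Finset.mem_union_left _ h''
      · exact absurd (Finset.mem_singleton.1 h'') h'

end Extend
/-! ## Renaming constants, domain by domain -/

section Rename

variable {dom : Name → Set Name} {S : Schema}

open Classical in
/-- The domains of the attributes of a relation. -/
noncomputable def Schema.domains (S : Schema) (r : Name) : List Name :=
  if h : ∃ ds, (r, ds) ∈ S.rels then h.choose else []

theorem Schema.Valid.domains_eq (hS : S.Valid) {r : Name} {ds : List Name}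
    (h : (r, ds) ∈ S.rels) : S.domains r = ds := by
  have h' : ∃ ds, (r, ds) ∈ S.rels := ⟨ds, h⟩
  rw [Schema.domains, dif_pos h']
  exact hS.unique h'.choose_spec h

/-- Applies `g d` to the constants in attributes with domain `d`. -/
noncomputable def renameFact (S : Schema) (g : Name → Name → Name) (f : Fact) : Fact :=
  (f.1, List.zipWith g (S.domains f.1) f.2)

noncomputable def renameConf (S : Schema) (g : Name → Name → Name) (C : Finset Fact) :
    Finset Fact := C.image (renameFact S g)

noncomputable def renameAccess (S : Schema) (g : Name → Name → Name) (a : Access) : Access :=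
  ⟨a.method, List.zipWith (fun d o => o.map (g d)) (S.domains a.method.rel) a.bind⟩

noncomputable def renameStep (S : Schema) (g : Name → Name → Name) (s : AccessStep) : AccessStep :=
  ⟨renameAccess S g s.access, renameConf S g s.resp⟩

variable {g : Name → Name → Name}

theorem mem_zip_zipWith {α β γ : Type*} {φ : β → α → γ} {l : List α} {ds : List β} {c : γ} {d : β} :
    (c, d) ∈ (List.zipWith φ ds l).zip ds ↔ ∃ v, (v, d) ∈ l.zip ds ∧ φ d v = c := by
  induction l generalizing ds with
  | nil => simp
  | cons a l ih =>
    cases ds with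
    | nil => simp
    | cons e ds =>
      simp only [List.zipWith_cons_cons, List.zip_cons_cons, List.mem_cons, Prod.mk.injEq, ih]
      constructor
      · rintro (⟨rfl, rfl⟩ | ⟨v, hv, rfl⟩)
        · exact ⟨a, .inl ⟨rfl, rfl⟩, rfl⟩
        · exact ⟨v, .inr hv, rfl⟩
      · rintro ⟨v, ⟨rfl, rfl⟩ | hv, rfl⟩
        · exact .inl ⟨rfl, rfl⟩
        · exact .inr ⟨v, hv, rfl⟩

theorem zipWith_eq_self {α β : Type*} {φ : β → α → α} {l : List α} {ds : List β}
    (hl : l.length = ds.length) (h : ∀ v d, (v, d) ∈ l.zip ds → φ d v = v) :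
    List.zipWith φ ds l = l := by
  induction l generalizing ds with
  | nil => simp
  | cons a l ih =>
    cases ds with
    | nil => simp at hl
    | cons e ds =>
      simp only [List.zip_cons_cons, List.mem_cons, Prod.mk.injEq] at h
      rw [List.zipWith_cons_cons, h a e (.inl ⟨rfl, rfl⟩),
        ih (by simpa using hl) fun v d hvd => h v d (.inr hvd)]

theorem WellTyped.rename (hS : S.Valid) (hg : ∀ d, ∀ c ∈ dom d, g d c ∈ dom d) {f : Fact}
    (hf : WellTyped dom S f) : WellTyped dom S (renameFact S g f) := by
  obtain ⟨ds, h1, h2⟩ := hf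
  refine ⟨ds, h1, ?_⟩
  rw [renameFact, hS.domains_eq h1]
  rw [List.forall₂_iff_zip] at h2 ⊢
  refine ⟨by simp [h2.1], fun {c d} hcd => ?_⟩
  obtain ⟨v, hv, rfl⟩ := mem_zip_zipWith.1 hcd
  exact hg d v (h2.2 hv)

theorem IsInstance.rename (hS : S.Valid) (hg : ∀ d, ∀ c ∈ dom d, g d c ∈ dom d) {C : Finset Fact}
    (hC : IsInstance dom S C) : IsInstance dom S (renameConf S g C) := by
  intro f hf
  obtain ⟨f', hf', rfl⟩ := Finset.mem_image.1 hf
  exact (hC f' hf').rename hS hg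

theorem mem_adom_renameConf (hS : S.Valid) {C : Finset Fact} {c d : Name} :
    (c, d) ∈ adom S (renameConf S g C) ↔ ∃ v, (v, d) ∈ adom S C ∧ g d v = c := by
  constructor
  · rintro ⟨f, hf, ds, h1, h2⟩
    obtain ⟨f', hf', rfl⟩ := Finset.mem_image.1 hf
    simp only [renameFact] at h1 h2
    rw [hS.domains_eq h1] at h2
    obtain ⟨v, hv, rfl⟩ := mem_zip_zipWith.1 h2
    exact ⟨v, ⟨f', hf', ds, h1, hv⟩, rfl⟩
  · rintro ⟨v, ⟨f, hf, ds, h1, h2⟩, rfl⟩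
    refine ⟨_, Finset.mem_image_of_mem _ hf, ds, h1, ?_⟩
    rw [renameFact, hS.domains_eq h1]
    exact mem_zip_zipWith.2 ⟨v, h2, rfl⟩

theorem renameFact_eq_self (hS : S.Valid) {f : Fact} (hf : WellTyped dom S f)
    (h : ∀ c d, (c, d) ∈ adom S {f} → g d c = c) : renameFact S g f = f := by
  obtain ⟨ds, h1, h2⟩ := hf
  refine Prod.ext rfl ?_
  rw [renameFact, hS.domains_eq h1]
  exact zipWith_eq_self h2.length_eq fun c d hcd =>
    h c d ⟨f, Finset.mem_singleton_self f, ds, h1, hcd⟩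

theorem renameConf_eq_self (hS : S.Valid) {C : Finset Fact} (hC : IsInstance dom S C)
    (h : ∀ c d, (c, d) ∈ adom S C → g d c = c) : renameConf S g C = C := by
  have : ∀ f ∈ C, renameFact S g f = f := fun f hf => renameFact_eq_self hS (hC f hf)
    fun c d hcd => h c d (adom_mono (by simpa using hf) hcd)
  rw [renameConf, Finset.image_congr (g := id) fun f hf => this f hf, Finset.image_id]

theorem renameConf_union (C D : Finset Fact) :
    renameConf S g (C ∪ D) = renameConf S g C ∪ renameConf S g D := Finset.image_union _ _

theorem Access.WellFormed.bind_length (hS : S.Valid) {C : Finset Fact} {a : Access}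
    (h : a.WellFormed dom S C) {ds : List Name} (hds : (a.method.rel, ds) ∈ S.rels) :
    a.bind.length = ds.length := by
  obtain ⟨ds', h1, h2⟩ := hS.2 _ h.1
  rw [hS.unique hds h1, ← h2, ← h.2.1, List.length_map]

theorem map_isSome_zipWith {α β γ : Type*} {φ : β → α → γ} {l : List (Option α)} {ds : List β}
    (hl : l.length = ds.length) :
    (List.zipWith (fun d o => o.map (φ d)) ds l).map Option.isSome = l.map Option.isSome := by
  induction l generalizing ds with
  | nil => simp
  | cons a l ih =>
    cases ds with
    | nil => simp at hl
    | cons e ds => simp [ih (by simpa using hl : l.length = ds.length)]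

theorem Access.WellFormed.rename (hS : S.Valid) (hg : ∀ d, ∀ c ∈ dom d, g d c ∈ dom d)
    {C : Finset Fact} {a : Access} (h : a.WellFormed dom S C) :
    (renameAccess S g a).WellFormed dom S (renameConf S g C) := by
  have hlen := fun {ds} => h.bind_length hS (ds := ds)
  obtain ⟨h1, h2, ds, h3, h4⟩ := h
  refine ⟨h1, ?_, ds, h3, fun c d hcd => ?_⟩
  · change (renameAccess S g a).bind.map Option.isSome = a.method.input
    rw [← h2]
    simp only [renameAccess, hS.domains_eq h3]
    exact map_isSome_zipWith (hlen h3)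
  · simp only [renameAccess, hS.domains_eq h3] at hcd
    obtain ⟨o, ho, hoc⟩ := mem_zip_zipWith.1 hcd
    obtain ⟨v, rfl, rfl⟩ := Option.map_eq_some_iff.1 hoc
    exact ⟨hg d v (h4 v d ho).1, fun hd => (mem_adom_renameConf hS).2 ⟨v, (h4 v d ho).2 hd, rfl⟩⟩

theorem Access.Matches.rename {a : Access} {f : Fact} (h : a.Matches f) :
    (renameAccess S g a).Matches (renameFact S g f) := by
  refine ⟨h.1, ?_⟩
  have key : ∀ (l : List (Option Name)) (t ds : List Name),
      List.Forall₂ (fun o c => ∀ v, o = some v → c = v) l t →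
      List.Forall₂ (fun o c => ∀ v, o = some v → c = v)
        (List.zipWith (fun d o => o.map (g d)) ds l) (List.zipWith g ds t) := by
    intro l t ds hlt
    induction hlt generalizing ds with
    | nil => simp
    | cons h1 _ ih =>
      cases ds with
      | nil => simp
      | cons e ds =>
        refine List.Forall₂.cons (fun v hv => ?_) (ih ds)
        obtain ⟨w, hw, rfl⟩ := Option.map_eq_some_iff.1 hv
        rw [h1 w hw]
  have := key _ _ (S.domains f.1) h.2
  simp only [renameAccess, renameFact]
  rwa [← h.1]

theorem IsPath.rename (hS : S.Valid) (hg : ∀ d, ∀ c ∈ dom d, g d c ∈ dom d) {I C : Finset Fact}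
    {p : List AccessStep} (h : IsPath dom S I C p) :
    IsPath dom S (renameConf S g I) (renameConf S g C) (p.map (renameStep S g)) := by
  induction p generalizing C with
  | nil => trivial
  | cons s p ih =>
    refine ⟨⟨h.1.1.rename hS hg, fun f hf => ?_⟩, ?_⟩
    · obtain ⟨f', hf', rfl⟩ := Finset.mem_image.1 hf
      exact ⟨Finset.mem_image_of_mem _ (h.1.2 f' hf').1, (h.1.2 f' hf').2.rename⟩
    · have := ih h.2
      rwa [renameConf_union] at this

theorem endConf_rename (C : Finset Fact) (p : List AccessStep) :
    endConf (renameConf S g C) (p.map (renameStep S g)) = renameConf S g (endConf C p) := by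
  induction p generalizing C with
  | nil => rfl
  | cons s p ih => rw [List.map_cons, endConf, endConf, ← ih, renameConf_union]; rfl

/-- All occurrences of a variable share one domain, so its value can be renamed by the map for that
domain. Constants of the query lie in the active domain of `C₀`, where the renaming is the identity.
-/
theorem CQ.Holds.rename (hS : S.Valid) {C₀ C : Finset Fact} {Q : CQ} (hQ : CQ.Valid S C₀ Q)
    (hg : ∀ c d, (c, d) ∈ adom S C₀ → g d c = c) (h : CQ.Holds Q C) :
    CQ.Holds Q (renameConf S g C) := by
  classical
  obtain ⟨v, hv⟩ := h
  obtain ⟨hQ1, hQ2, hQ3⟩ := hQ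
  let w : Name → Name := fun x =>
    if hx : ∃ d, CQ.Occurs S Q (.var x) d then g hx.choose (v x) else v x
  have hw : ∀ x d, CQ.Occurs S Q (.var x) d → w x = g d (v x) := by
    intro x d hd
    have hx : ∃ d, CQ.Occurs S Q (.var x) d := ⟨d, hd⟩
    simp only [w, dif_pos hx]
    rw [hQ2 x _ _ hx.choose_spec hd]
  refine ⟨w, fun A hA => Finset.mem_image.2 ⟨_, hv A hA, ?_⟩⟩
  obtain ⟨ds, h1, h2⟩ := hQ1 A hA
  simp only [renameFact, hS.domains_eq h1, Prod.mk.injEq, true_and]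
  have key : ∀ (l : List Term) (ds : List Name), l.length = ds.length →
      (∀ t d, (t, d) ∈ l.zip ds → CQ.Occurs S Q t d) →
      List.zipWith g ds (l.map (Term.eval v)) = l.map (Term.eval w) := by
    intro l
    induction l with
    | nil => simp
    | cons t l ih =>
      intro ds hl ho
      cases ds with
      | nil => simp at hl
      | cons e ds =>
        rw [List.map_cons, List.map_cons, List.zipWith_cons_cons,
          ih ds (by simpa using hl) fun t d h => ho t d (List.mem_cons_of_mem _ h)]
        have h0 := ho t e List.mem_cons_self
        cases t with
        | var x => simp [Term.eval, hw x e h0]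
        | const c => simp [Term.eval, hg c e (hQ3 c e h0)]
  exact key _ _ h2 fun t d htd => ⟨A, hA, ds, h1, htd⟩

theorem renameConf_renameConf (hS : S.Valid) {C : Finset Fact} (hC : IsInstance dom S C)
    (hg : ∀ d c, g d (g d c) = c) : renameConf S g (renameConf S g C) = C := by
  rw [renameConf, renameConf, Finset.image_image]
  conv_rhs => rw [← Finset.image_id (s := C)]
  refine Finset.image_congr fun f hf => ?_
  obtain ⟨ds, h1, h2⟩ := hC f hf
  refine Prod.ext rfl ?_
  simp only [Function.comp, renameFact, hS.domains_eq h1, id]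
  have key : ∀ (l ds : List Name), l.length = ds.length →
      List.zipWith g ds (List.zipWith g ds l) = l := by
    intro l
    induction l with
    | nil => simp
    | cons a l ih =>
      intro ds hl
      cases ds with
      | nil => simp at hl
      | cons e ds => simp [hg, ih ds (by simpa using hl)]
  exact key _ _ h2.length_eq

/-- A constant that is not in the initial configuration can be avoided along a path. -/
theorem exists_path_avoiding (hdom : ∀ d, (dom d).Infinite) (hS : S.Valid) {C I : Finset Fact}
    {Q : CQ} (hI : IsInstance dom S I) (hCI : C ⊆ I) (hQ : CQ.Valid S C Q)
    {p : List AccessStep} (hp : IsPath dom S I C p) {c d : Name} (hc : c ∈ dom d)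
    (hcd : (c, d) ∉ adom S C) :
    ∃ I' p', IsInstance dom S I' ∧ C ⊆ I' ∧ IsPath dom S I' C p' ∧
      (c, d) ∉ adom S (endConf C p') ∧
      (CQ.Holds Q (endConf C p') → CQ.Holds Q (endConf C p)) ∧
      ∀ d', (∃ v, (v, d') ∈ adom S (endConf C p)) → ∃ v, (v, d') ∈ adom S (endConf C p') := by
  classical
  have hC : IsInstance dom S C := hI.mono hCI
  have hfin : {v | (v, d) ∈ adom S I}.Finite := by
    refine (I.finite_toSet.biUnion fun f _ => (List.finite_toSet f.2)).subset ?_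
    rintro v ⟨f, hf, ds, -, h2⟩
    exact Set.mem_biUnion hf (List.of_mem_zip h2).1
  -- The replacement for `c` is new for domain `d` in the whole instance, not only on the path.
  obtain ⟨e, he, heI⟩ := (hdom d).exists_notMem_finite hfin
  -- Swapping only in domain `d` keeps all values in their domains even if domains overlap, and
  -- fixes everything in the active domain of C. As an involution it also transfers the query back.
  let g : Name → Name → Name := fun d' v => if d' = d then Equiv.swap c e v else v
  have hg1 : ∀ d', ∀ v ∈ dom d', g d' v ∈ dom d' := by
    intro d' v hv
    simp only [g]
    split_ifs with h
    · subst h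
      rw [Equiv.swap_apply_def]
      split_ifs <;> assumption
    · exact hv
  have hg2 : ∀ d' v, g d' (g d' v) = v := by
    intro d' v
    simp only [g]
    split_ifs <;> simp
  have hg3 : ∀ v d', (v, d') ∈ adom S C → g d' v = v := by
    intro v d' hv
    simp only [g]
    split_ifs with h
    · subst h
      refine Equiv.swap_apply_of_ne_of_ne ?_ ?_
      · rintro rfl; exact hcd hv
      · rintro rfl; exact heI (adom_mono hCI hv)
    · rfl
  have hCg := renameConf_eq_self hS hC hg3
  have hD : IsInstance dom S (endConf C p) := hI.mono (hp.endConf_subset hCI)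
  have hend : endConf C (p.map (renameStep S g)) = renameConf S g (endConf C p) := by
    conv_lhs => rw [← hCg]
    exact endConf_rename C p
  refine ⟨renameConf S g I, p.map (renameStep S g), hI.rename hS hg1, ?_, ?_, ?_, ?_, ?_⟩
  · rw [← hCg]; exact Finset.image_subset_image hCI
  · have := hp.rename hS hg1
    rwa [hCg] at this
  · rw [hend, mem_adom_renameConf hS]
    rintro ⟨v, hv, hvc⟩
    simp only [g, if_true] at hvc
    rw [Equiv.swap_apply_eq_iff, Equiv.swap_apply_left] at hvc
    subst hvc
    exact heI (adom_mono (hp.endConf_subset hCI) hv)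
  · intro h
    rw [hend] at h
    have := h.rename hS hQ hg3
    rwa [renameConf_renameConf hS hD hg2] at this
  · rintro d' ⟨v, hv⟩
    rw [hend]
    exact ⟨g d' v, (mem_adom_renameConf hS).2 ⟨v, hv, rfl⟩⟩

end Rename
section Relevance

variable {dom : Name → Set Name} {S : Schema} {n : Name} {es : List Name}

/-! ## Boolean accesses -/

theorem Access.IsBoolean.exists_tuple {C : Finset Fact} {a : Access} (h : a.IsBoolean)
    (ha : a.WellFormed dom S C) : ∃ t : List Name, a.bind = t.map some := by
  have : ∀ o ∈ a.bind, Option.isSome o = true := fun o ho =>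
    h _ (ha.2.1 ▸ List.mem_map_of_mem ho)
  generalize a.bind = l at this
  induction l with
  | nil => exact ⟨[], rfl⟩
  | cons o l ih =>
    obtain ⟨v, rfl⟩ := Option.isSome_iff_exists.1 (this o List.mem_cons_self)
    obtain ⟨t, rfl⟩ := ih fun o ho => this o (List.mem_cons_of_mem _ ho)
    exact ⟨v :: t, rfl⟩

theorem Access.matches_iff {a : Access} {t : List Name} (h : a.bind = t.map some) (f : Fact) :
    a.Matches f ↔ f = (a.method.rel, t) := by
  rw [Access.Matches, h, List.forall₂_map_left_iff, Prod.ext_iff]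
  refine and_congr_right fun _ => ?_
  have : (fun (a c : Name) => ∀ v, some a = some v → c = v) = fun a c => a = c := by
    funext a c
    simp [eq_comm]
  rw [this, List.forall₂_eq_eq_eq, eq_comm]

theorem Access.WellFormed.wellTyped (hS : S.Valid) {C : Finset Fact} {a : Access}
    (ha : a.WellFormed dom S C) {t : List Name} (h : a.bind = t.map some) :
    WellTyped dom S (a.method.rel, t) := by
  have hlen := fun {ds} => ha.bind_length hS (ds := ds)
  obtain ⟨-, -, ds, h3, h4⟩ := ha
  refine ⟨ds, h3, List.forall₂_iff_zip.2 ⟨by simpa [h] using hlen h3, fun {c d} hcd => ?_⟩⟩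
  refine (h4 c d ?_).1
  rw [h, List.zip_map_left]
  exact List.mem_map.2 ⟨_, hcd, rfl⟩

/-! ## Queries for the inhabited domains -/

/-- The variable for the attribute `j` of the relation `r`. -/
def attributeVar (r : Name) (j : ℕ) : Name := List.replicate j false ++ true :: r

theorem takeWhile_attributeVar (r : Name) (j : ℕ) :
    ((attributeVar r j).takeWhile (!·)).length = j := by
  simp [attributeVar]

theorem dropWhile_attributeVar (r : Name) (j : ℕ) :
    ((attributeVar r j).dropWhile (!·)).tail = r := by
  simp [attributeVar]

/-- The name is self-delimiting: the number of leading `false` bits is the position, the first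
`true` separates it from the relation. -/
theorem attributeVar_inj {r r' : Name} {j j' : ℕ} (h : attributeVar r j = attributeVar r' j') :
    r = r' ∧ j = j' :=
  ⟨by rw [← dropWhile_attributeVar r j, h, dropWhile_attributeVar],
    by rw [← takeWhile_attributeVar r j, h, takeWhile_attributeVar]⟩

/-- The atom over a relation with distinct variables. -/
def genericAtom (x : Name × List Name) : Atom :=
  ⟨x.1, (List.range x.2.length).map fun j => .var (attributeVar x.1 j)⟩

/-- The query that the given relations are not empty. -/
def genericQuery (L : List (Name × List Name)) : CQ := L.map genericAtom

/-- A variable determines its relation and position, hence its domain, and there are no constants.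
-/
theorem genericQuery_valid (hS : S.Valid) (C : Finset Fact) {L : List (Name × List Name)}
    (hL : ∀ x ∈ L, x ∈ S.rels) : CQ.Valid S C (genericQuery L) := by
  have occ : ∀ t d, CQ.Occurs S (genericQuery L) t d → ∃ r ds j, (r, ds) ∈ S.rels ∧
      t = .var (attributeVar r j) ∧ ds[j]? = some d := by
    rintro t d ⟨A, hA, ds, h1, h2⟩
    obtain ⟨⟨r, ds'⟩, hx, rfl⟩ := List.mem_map.1 hA
    have hds : ds = ds' := hS.unique h1 (hL _ hx)
    subst hds
    obtain ⟨j, hj, hjt⟩ := List.mem_iff_getElem.1 h2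
    simp only [genericAtom, List.getElem_zip, List.getElem_map, List.getElem_range,
      Prod.mk.injEq] at hjt
    have hj' : j < ds.length := by simp at hj; omega
    exact ⟨r, ds, j, hL _ hx, hjt.1.symm, by rw [List.getElem?_eq_getElem hj', hjt.2]⟩
  refine ⟨fun A hA => ?_, fun x d d' h h' => ?_, fun c d h => ?_⟩
  · obtain ⟨x, hx, rfl⟩ := List.mem_map.1 hA
    exact ⟨x.2, hL _ hx, by simp [genericAtom]⟩
  · obtain ⟨r, ds, j, h1, h2, h3⟩ := occ _ _ h
    obtain ⟨r', ds', j', h1', h2', h3'⟩ := occ _ _ h'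
    obtain ⟨rfl, rfl⟩ := attributeVar_inj (Term.var.inj (h2.symm.trans h2'))
    rw [hS.unique h1 h1', h3'] at h3
    exact (Option.some.inj h3).symm
  · obtain ⟨r, ds, j, -, h2, -⟩ := occ _ _ h
    cases h2

/-- Each variable belongs to one position of one relation, so any choice of a fact for each relation
defines a valuation, read off by decoding the variable name. -/
theorem holds_genericQuery (hS : S.Valid) {D : Finset Fact} (hD : IsInstance dom S D)
    {L : List (Name × List Name)} (hL : ∀ x ∈ L, x ∈ S.rels) (h : ∀ x ∈ L, ∃ f ∈ D, f.1 = x.1) :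
    CQ.Holds (genericQuery L) D := by
  classical
  let φ : Name → Fact := fun r => if h : ∃ f ∈ D, f.1 = r then h.choose else ([], [])
  have hφ : ∀ x ∈ L, φ x.1 ∈ D ∧ (φ x.1).1 = x.1 := fun x hx => by
    simp only [φ, dif_pos (h x hx)]
    exact (h x hx).choose_spec
  let v : Name → Name := fun x =>
    (φ ((x.dropWhile (!·)).tail)).2.getD ((x.takeWhile (!·)).length) []
  refine ⟨v, fun A hA => ?_⟩
  obtain ⟨⟨r, ds⟩, hx, rfl⟩ := List.mem_map.1 hA
  obtain ⟨h1, h2⟩ := hφ _ hx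
  have h3 := ((hD _ h1).forall₂ hS (by rw [h2]; exact hL _ hx)).length_eq
  suffices (genericAtom (r, ds)).args.map (Term.eval v) = (φ r).2 by
    rw [this]
    change (r, (φ r).2) ∈ D
    rwa [show (r, (φ r).2) = φ r from Prod.ext h2.symm rfl]
  simp only [genericAtom, List.map_map]
  simp only at h3
  apply List.ext_getElem
  · simp [h3]
  · intro i hi hi'
    simp only [List.getElem_map, List.getElem_range, Function.comp, Term.eval, v,
      dropWhile_attributeVar, takeWhile_attributeVar]
    rw [List.getD_eq_getElem _ _ hi']

theorem exists_mem_adom_of_holds (hS : S.Valid) {D : Finset Fact} (hD : IsInstance dom S D)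
    {Q : CQ} (hQ : CQ.Holds Q D) {A : Atom} (hA : A ∈ Q) {ds : List Name} {d : Name}
    (hds : (A.rel, ds) ∈ S.rels) (hd : d ∈ ds) : ∃ v, (v, d) ∈ adom S D := by
  obtain ⟨v, hv⟩ := hQ
  have hlen := ((hD _ (hv A hA)).forall₂ hS hds).length_eq
  obtain ⟨j, hj, rfl⟩ := List.mem_iff_getElem.1 hd
  simp only at hlen
  have hj' : j < ((A.args.map (Term.eval v)).zip ds).length := by rw [List.length_zip]; omega
  exact ⟨(A.args.map (Term.eval v))[j], _, hv A hA, ds, hds,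
    List.mem_iff_getElem.2 ⟨j, hj', List.getElem_zip⟩⟩

/-! ## Relevance in terms of containment -/

theorem longTermRelevant_of_redirect (hS : S.Valid) (hn : n ∉ S.rels.map Prod.fst)
    {C : Finset Fact} (hC : IsInstance dom S C) {Q Q' : CQ} (hQ : CQ.Valid S C Q) {a : Access}
    (ha : a.WellFormed dom S C) {t : List Name} (hat : a.bind = t.map some)
    (hr : (a.method.rel, es) ∈ S.rels)
    (hQQ' : List.Forall₂ (Atom.Redirect a.method.rel n) Q Q')
    (h : ¬ ContainedFrom dom (S.extend n es) (C ∪ {(n, t)}) Q' Q) :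
    LongTermRelevant dom S C Q a := by
  have ht := ha.wellTyped hS hat
  have hQn : ∀ A ∈ Q, A.rel ≠ n := fun A hA => by
    obtain ⟨ds, h1, -⟩ := hQ.1 A hA
    exact ne_of_mem_rels hn h1
  simp only [ContainedFrom, not_forall] at h
  obtain ⟨C', hC', hQ', hnQ⟩ := h
  obtain ⟨I, p, hI, hCI, hp, rfl⟩ := (reachable_extend_iff hS hn hr ht hC).1 hC'
  have hend : endConf C p ⊆ I :=
    (endConf_mono Finset.subset_union_left p).trans (hp.endConf_subset hCI)
  rw [longTermRelevant_iff ha (Access.matches_iff hat)]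
  refine ⟨I, p, hI, hCI, hp, hQ'.of_redirect hQQ' (fun f hf => (hI.mono hend).rel_ne hn hf) hQn,
    fun h' => hnQ (h'.mono ?_)⟩
  exact (endConf_wellFormedPrefix_subset C p).trans Finset.subset_union_left

/-- The path refutes containment first, then gets an access that is possible only thanks to F, and
then makes Q true; the truncation stops before Q becomes true. Of `Q'` only the domains that it
forces to be inhabited matter, so it need not be a generic query. -/
theorem longTermRelevant_of_new_access (hdom : ∀ d, (dom d).Infinite) (hS : S.Valid)
    (hn : n ∉ S.rels.map Prod.fst) {C : Finset Fact} (hC : IsInstance dom S C) {Q Q' : CQ}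
    (hQ : CQ.Valid S C Q) {a : Access} (ha : a.WellFormed dom S C) {t : List Name}
    (hat : a.bind = t.map some) (hr : (a.method.rel, es) ∈ S.rels)
    (h : ¬ ContainedFrom dom (S.extend n es) (C ∪ {(n, t)}) Q' Q)
    {C₂ : Finset Fact} (hC₂ : Reachable dom S (C ∪ {(a.method.rel, t)}) C₂)
    (hQC₂ : CQ.Holds Q C₂) {m : AccessMethod} (hm : m ∈ S.methods) (hdep : m.dependent = true)
    {ds : List Name} (hds : (m.rel, ds) ∈ S.rels)
    (hinp : ∀ d, (true, d) ∈ m.input.zip ds →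
      ∃ A ∈ Q', ∃ ds', (A.rel, ds') ∈ (S.extend n es).rels ∧ d ∈ ds')
    {c d : Name} (hd : (true, d) ∈ m.input.zip ds) (hcd : (c, d) ∈ t.zip es)
    (hnew : (c, d) ∉ adom S C) : LongTermRelevant dom S C Q a := by
  classical
  have ht := ha.wellTyped hS hat
  set F : Fact := (a.method.rel, t) with hF
  simp only [ContainedFrom, not_forall] at h
  obtain ⟨C', hC', hQ', hnQ⟩ := h
  obtain ⟨I, p, hI, hCI, hp, rfl⟩ := (reachable_extend_iff hS hn hr ht hC).1 hC'
  obtain ⟨I₂, hI₂, hCI₂, p₂, hp₂, rfl⟩ := hC₂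
  replace hnQ : ¬ CQ.Holds Q (endConf C p) := fun h => hnQ (h.mono Finset.subset_union_left)
  have hD : IsInstance dom S (endConf C p) := hI.mono <|
    (endConf_mono Finset.subset_union_left p).trans (hp.endConf_subset hCI)
  rw [longTermRelevant_iff ha (Access.matches_iff hat)]
  -- If `p` is a path from C, a dependence on F has to be inserted; otherwise it contains one
  -- already.
  by_cases hw : wellFormedPrefix dom S C p = p
  · have hext : IsInstance dom (S.extend n es) (endConf C p ∪ {(n, t)}) := hD.extend.union
      (isInstance_singleton.2 ⟨es, List.mem_cons_self, ht.forall₂ hS hr⟩)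
    have hinh : ∀ d, (true, d) ∈ m.input.zip ds → ∃ v, (v, d) ∈ adom S (endConf C p ∪ {F}) := by
      intro d hd
      obtain ⟨A, hA, ds', h1, h2⟩ := hinp d hd
      rw [hF, ← adom_extend_union hS hn hr hD]
      exact exists_mem_adom_of_holds (hS.extend hn) hext hQ' hA h1 h2
    have hcdF : (c, d) ∈ adom S {F} := by rw [hF, adom_singleton hS hr]; exact hcd
    have hcdom : c ∈ dom d := mem_dom_of_mem_adom hS (isInstance_singleton.2 ht) hcdF
    -- The path `p` may have discovered `c` in domain `d` by itself; it is renamed so that only F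
    -- supplies this value.
    obtain ⟨I', p', hI', hCI', hp', hcd', hQp', hdp'⟩ := exists_path_avoiding hdom hS hI
      (Finset.subset_union_left.trans hCI) hQ (hp.of_wellFormedPrefix_eq hw) hcdom hnew
    have hD' : IsInstance dom S (endConf C p') := hI'.mono (hp'.endConf_subset hCI')
    have hDF : IsInstance dom S (endConf C p' ∪ {F}) := hD'.union (isInstance_singleton.2 ht)
    -- Inputs of domain `d` get the new value `c`, the other inputs any active value of their
    -- domain; the default `[]` never occurs at an input.
    let pick : Name → Name := fun d' => if d' = d then c else
      if h : ∃ v, (v, d') ∈ adom S (endConf C p' ∪ {F}) then h.choose else []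
    have hpick : ∀ d', (true, d') ∈ m.input.zip ds →
        (pick d', d') ∈ adom S (endConf C p' ∪ {F}) := by
      intro d' hd'
      simp only [pick]
      split_ifs with h1 h2
      · subst h1
        exact adom_mono Finset.subset_union_right hcdF
      · exact h2.choose_spec
      · obtain ⟨v, hv⟩ := hinh d' hd'
        rw [adom_union] at hv h2
        rcases hv with hv | hv
        · obtain ⟨w, hw⟩ := hdp' d' ⟨v, hv⟩
          exact absurd ⟨w, .inl hw⟩ h2
        · exact absurd ⟨v, .inr hv⟩ h2
    let b : List (Option Name) :=
      List.zipWith (fun d' (i : Bool) => if i then some (pick d') else none) ds m.input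
    have hmem : ∀ o d', (o, d') ∈ b.zip ds ↔ ∃ i : Bool, (i, d') ∈ m.input.zip ds ∧
      (if i then some (pick d') else none) = o := fun o d' => mem_zip_zipWith
    have hb : b.map Option.isSome = m.input := by
      obtain ⟨ds', h1, h2⟩ := hS.2 m hm
      rw [← hS.unique hds h1] at h2
      simp only [b, List.map_zipWith]
      refine zipWith_eq_self h2 fun i d' _ => ?_
      cases i <;> simp
    -- The response is empty: the access serves only to block the truncated path.
    let s : AccessStep := ⟨⟨m, b⟩, ∅⟩
    have hs : s.access.WellFormed dom S (endConf C p' ∪ {F}) := by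
      refine ⟨hm, hb, ds, hds, fun c' d' hcd' => ?_⟩
      obtain ⟨i, hi, hi'⟩ := (hmem _ _).1 hcd'
      cases i with
      | false => simp at hi'
      | true =>
        simp only [if_true, Option.some.injEq] at hi'
        subst hi'
        exact ⟨mem_dom_of_mem_adom hS hDF (hpick d' hi), fun _ => hpick d' hi⟩
    have hs' : ¬ s.access.WellFormed dom S (endConf C p') := by
      rintro ⟨-, -, ds', h1, h2⟩
      obtain rfl := hS.unique hds h1
      refine hcd' ((h2 c d ((hmem _ _).2 ⟨true, hd, by simp [pick]⟩)).2 hdep)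
    refine ⟨I' ∪ I₂, p' ++ s :: p₂, hI'.union hI₂, hCI₂.trans Finset.subset_union_right,
      isPath_append.2 ⟨hp'.mono Finset.subset_union_left Finset.subset_union_left, ?_⟩, ?_, ?_⟩
    · rw [endConf_union]
      refine ⟨⟨hs, fun f hf => absurd hf (Finset.notMem_empty f)⟩,
        hp₂.mono Finset.subset_union_right ?_⟩
      exact (Finset.union_subset_union_left (subset_endConf C p')).trans Finset.subset_union_left
    · refine hQC₂.mono ?_
      rw [← endConf_union, endConf_append, endConf]
      refine endConf_mono ?_ _
      exact (subset_endConf _ _).trans Finset.subset_union_left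
    · rw [hp'.wellFormedPrefix_append, wellFormedPrefix, if_neg hs', List.append_nil]
      exact fun h => hnQ (hQp' h)
  · refine ⟨I ∪ I₂, p ++ p₂, hI.union hI₂, hCI.trans Finset.subset_union_left,
      isPath_append.2 ⟨hp.mono Finset.subset_union_left subset_rfl,
        hp₂.mono Finset.subset_union_right (subset_endConf _ _)⟩, ?_, ?_⟩
    · refine hQC₂.mono ?_
      rw [← endConf_union, endConf_append]
      exact endConf_mono (subset_endConf _ _) _
    · rw [wellFormedPrefix_append_of_ne hw]
      exact fun h => hnQ (h.mono (endConf_wellFormedPrefix_subset C p))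

/-- The alternative is whether F is needed as a fact for Q or only as a source of input values. The
query in the second case says that the relations nonempty just before the blocked step are nonempty.
-/
theorem LongTermRelevant.redirect_or_new_access (hS : S.Valid) (hn : n ∉ S.rels.map Prod.fst)
    {C : Finset Fact} (hC : IsInstance dom S C) {Q : CQ} (hQ : CQ.Valid S C Q) {a : Access}
    (ha : a.WellFormed dom S C) {t : List Name} (hat : a.bind = t.map some)
    (hr : (a.method.rel, es) ∈ S.rels) (h : LongTermRelevant dom S C Q a) :
    (∃ Q', List.Forall₂ (Atom.Redirect a.method.rel n) Q Q' ∧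
      ¬ ContainedFrom dom (S.extend n es) (C ∪ {(n, t)}) Q' Q) ∨
    ((∃ C₂, Reachable dom S (C ∪ {(a.method.rel, t)}) C₂ ∧ CQ.Holds Q C₂) ∧
      ∃ (L : List (Name × List Name)) (m : AccessMethod) (ds : List Name) (c d : Name),
        L.Sublist (S.extend n es).rels ∧
        ¬ ContainedFrom dom (S.extend n es) (C ∪ {(n, t)}) (genericQuery L) Q ∧
        m ∈ S.methods ∧ m.dependent = true ∧ (m.rel, ds) ∈ S.rels ∧
        (∀ d, (true, d) ∈ m.input.zip ds → ∃ x ∈ L, d ∈ x.2) ∧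
        (true, d) ∈ m.input.zip ds ∧ (c, d) ∈ t.zip es ∧ (c, d) ∉ adom S C) := by
  classical
  have ht := ha.wellTyped hS hat
  set F : Fact := (a.method.rel, t) with hF
  have hQn : ∀ A ∈ Q, A.rel ≠ n := fun A hA => by
    obtain ⟨ds, h1, -⟩ := hQ.1 A hA
    exact ne_of_mem_rels hn h1
  rw [longTermRelevant_iff ha (Access.matches_iff hat)] at h
  obtain ⟨I, q, hI, hCI, hq, hQ1, hQ2⟩ := h
  -- Here F is left out of the end configuration although it enabled the accesses of `q`.
  by_cases h0 : CQ.Holds Q (endConf C q)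
  · right
    refine ⟨⟨_, ⟨I, hI, hCI, q, hq, rfl⟩, h0.mono (endConf_mono Finset.subset_union_left q)⟩, ?_⟩
    have hne : wellFormedPrefix dom S C q ≠ q := fun h => hQ2 (h.symm ▸ h0)
    obtain ⟨s, r, hsplit, hs⟩ := exists_split_of_wellFormedPrefix_ne hne
    set q' := wellFormedPrefix dom S C q with hq'
    set D := endConf C q' with hD
    rw [hsplit, isPath_append, endConf_union, ← hD] at hq
    obtain ⟨hpq', ⟨hs', -⟩, -⟩ := hq
    have hDI : IsInstance dom S D := hI.mono <|
      (endConf_mono Finset.subset_union_left q').trans (hpq'.endConf_subset hCI)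
    have hext : IsInstance dom (S.extend n es) (D ∪ {(n, t)}) := hDI.extend.union
      (isInstance_singleton.2 ⟨es, List.mem_cons_self, ht.forall₂ hS hr⟩)
    obtain ⟨hm, hbind, ds, hds, hcond⟩ := hs'
    -- The step is well-formed with F and not without it, so it is dependent and some input value is
    -- not active at `D`; that value must come from F.
    have hex : s.access.method.dependent = true ∧
        ∃ c d, (some c, d) ∈ s.access.bind.zip ds ∧ (c, d) ∉ adom S D := by
      by_contra hcon
      refine hs ⟨hm, hbind, ds, hds, fun c d hcd => ⟨(hcond c d hcd).1, fun hdep => ?_⟩⟩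
      by_contra hcd'
      exact hcon ⟨hdep, c, d, hcd, hcd'⟩
    obtain ⟨hdep, c, d, hcd, hcdD⟩ := hex
    -- All relations inhabited at the blocked step are listed, including `n`, since some input
    -- domains may be inhabited by the tuple `t` only.
    refine ⟨(S.extend n es).rels.filter fun x => ∃ f ∈ D ∪ {(n, t)}, f.1 = x.1,
      s.access.method, ds, c, d, List.filter_sublist, ?_, hm, hdep, hds, ?_, ?_, ?_, ?_⟩
    · intro hcont
      have := hcont (D ∪ {(n, t)})
        ((reachable_extend_iff hS hn hr ht hC).2 ⟨I, q', hI, hCI, hpq', rfl⟩)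
        (holds_genericQuery (hS.extend hn) hext (fun x hx => (List.mem_filter.1 hx).1)
          fun x hx => by simpa using (List.mem_filter.1 hx).2)
      exact hQ2 ((CQ.holds_union_singleton hQn).1 this)
    · intro d' hd'
      rw [← hbind, List.zip_map_left] at hd'
      obtain ⟨⟨o, d''⟩, ho, heq⟩ := List.mem_map.1 hd'
      simp only [Prod.map, id, Prod.mk.injEq] at heq
      obtain ⟨ho', rfl⟩ := heq
      obtain ⟨v, rfl⟩ := Option.isSome_iff_exists.1 ho'
      have hv := (hcond v d'' ho).2 hdep
      rw [← adom_extend_union hS hn hr hDI] at hv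
      obtain ⟨f, hf, ds', h1, h2⟩ := hv
      exact ⟨(f.1, ds'), List.mem_filter.2 ⟨h1, decide_eq_true ⟨f, hf, rfl⟩⟩,
        (List.of_mem_zip h2).2⟩
    · rw [← hbind, List.zip_map_left]
      exact List.mem_map.2 ⟨_, hcd, rfl⟩
    · have hv := (hcond c d hcd).2 hdep
      rw [adom_union] at hv
      have := hv.resolve_left hcdD
      rwa [adom_singleton hS hr] at this
    · exact fun h => hcdD (adom_mono (subset_endConf _ _) h)
  · left
    obtain ⟨Q', h1, h2⟩ := hQ1.exists_redirect (n := n)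
    refine ⟨Q', h1, fun hcont => h0 ?_⟩
    exact (CQ.holds_union_singleton hQn).1 <| hcont _
      ((reachable_extend_iff hS hn hr ht hC).2 ⟨I, q, hI, hCI, hq, rfl⟩) h2

end Relevance
/-! ## Derived checks -/

namespace Chk

/-- The disjunction of two checks. -/
def or (a b : Chk) : Chk := not (and (not a) (not b))

/-- The check `c` holds for some member of the list `l`. -/
def ex (l : Expr) (c : Chk) : Chk := not (all2 l l (not c))

/-- The value of `e` is a member of the list `l`. -/
def mem (n : ℕ) (e l : Expr) : Chk := ex l (eq (.reg (n + 1)) e)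

variable {Ω : Set STree} {n : ℕ} {σ : ℕ → STree}

theorem holds_or {a b : Chk} : (a.or b).Holds Ω n σ ↔ a.Holds Ω n σ ∨ b.Holds Ω n σ := by
  simp only [or, Holds]
  tauto

theorem holds_ex {l : Expr} {c : Chk} : (ex l c).Holds Ω n σ ↔ ∃ t ∈ (l.eval σ).elems,
    c.Holds Ω (n + 5) (Function.update (Function.update σ (n + 1) t) (n + 2) t) := by
  simp [ex, Holds, List.forall₂_same]

theorem holds_mem {e l : Expr} (h : ∀ i ∈ e.reads, i ≤ n) :
    (mem n e l).Holds Ω n σ ↔ e.eval σ ∈ (l.eval σ).elems := by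
  rw [mem, holds_ex]
  have : ∀ t, e.eval (Function.update (Function.update σ (n + 1) t) (n + 2) t) = e.eval σ :=
    fun t => Expr.eval_congr e fun i hi => by
      have := h i hi
      rw [Function.update_of_ne (by omega), Function.update_of_ne (by omega)]
  simp [Holds, this, Expr.eval]

end Chk

/-! ## The check for long-term relevance -/

namespace RelevanceCheck

/-- The parts of the input: the relations of the schema. -/
def rels : Expr := .hd (.hd (.reg 0))
def methods : Expr := .tl (.hd (.reg 0))
def conf : Expr := .hd (.tl (.reg 0))
def query : Expr := .hd (.tl (.tl (.reg 0)))
def accRel : Expr := .hd (.hd (.tl (.tl (.tl (.reg 0)))))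
def accBind : Expr := .tl (.tl (.tl (.tl (.reg 0))))

/-- The parts of the guess: the name of a new relation. -/
def name : Expr := .hd (.reg 1)
def doms : Expr := .hd (.tl (.reg 1))
def tuple : Expr := .hd (.tl (.tl (.reg 1)))
def query' : Expr := .hd (.tl (.tl (.tl (.reg 1))))
def method : Expr := .hd (.tl (.tl (.tl (.tl (.reg 1)))))
def methodDoms : Expr := .tl (.tl (.tl (.tl (.tl (.reg 1)))))

/-- An oracle query for the schema with the relation `newRel` added. -/
def ask (newRel C Q₁ Q₂ : Expr) : Expr :=
  .cons (.cons (.cons newRel rels) methods) (.cons C (.cons Q₁ Q₂))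

/-- The guessed query arises from the given one by redirecting atoms. -/
def redirect : Chk :=
  .all2 query query' <| .and (.eq (.tl (.reg 4)) (.tl (.reg 3))) <|
    .or (.eq (.hd (.reg 4)) (.hd (.reg 3)))
      (.and (.eq (.hd (.reg 3)) accRel) (.eq (.hd (.reg 4)) name))

/-- All input domains of the guessed method occur in the guessed query. -/
def inhabited : Chk :=
  .all2 (.hd (.tl method)) methodDoms <| .or (.eq (.reg 3) .nil) <|
    .ex query' <| .ex (.cons (.cons name doms) rels) <|
      -- Quantifier levels are 2, 7 and 12: register 4 holds the input domain, 8 an atom of the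
      -- guessed query, and 13 a relation with its domains.
      .and (.eq (.hd (.reg 8)) (.hd (.reg 13))) (.mem 17 (.reg 4) (.tl (.reg 13)))

/-- The query that the constant in register `8` is in the new relation. -/
def constQuery : Expr :=
  .cons (.cons name (.cons (.cons (.cons .nil .nil) (.reg 8)) .nil)) .nil

/-- Some value of the access is new in an input domain of the guessed method. -/
def newConst : Chk :=
  .not <| .all2 (.hd (.tl method)) methodDoms <| .not <| .and (.not (.eq (.reg 3) .nil)) <|
    .not <| .all2 tuple doms <| .not <| .and (.eq (.reg 9) (.reg 4)) <| .not <|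
      -- This trivial containment is rejected only for invalid input, that is, if the constant is
      -- not active in the domain of the unary relation.
      .oracle (ask (.cons name (.cons (.reg 4) .nil)) conf constQuery constQuery)

/-- The check whether the access makes new accesses possible. -/
def newAccess : Chk :=
  -- The fresh name is reused for an empty nullary relation; a negative answer means that the query
  -- can become true from the configuration with F.
  .and (.not (.oracle (ask (.cons name .nil) (.cons (.cons accRel tuple) conf) query
    (.cons (.cons name .nil) .nil)))) <|
  .and (.mem 2 method methods) <|
  .and (.not (.eq (.tl (.tl method)) .nil)) <|
  .and (.mem 2 (.cons (.hd method) methodDoms) rels) <|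
  .and inhabited newConst

/-- The check that a guess proves the long-term relevance of the access. -/
def check : Chk :=
  .and (.mem 2 (.cons accRel doms) rels) <|
  .and (.all2 accBind tuple (.eq (.reg 3) (.cons .nil (.reg 4)))) <|
  -- A query is contained in itself, so this only asks whether the guess forms a valid input; in
  -- particular it tests freshness of the name.
  .and (.oracle (ask (.cons name doms) (.cons (.cons name tuple) conf) query' query')) <|
  .and (.not (.oracle (ask (.cons name doms) (.cons (.cons name tuple) conf) query' query))) <|
  .or redirect newAccess

theorem check_closed : check.Closed [0, 1] 2 := by
  simp [check, redirect, newAccess, inhabited, newConst, constQuery, ask, Chk.Closed, Chk.or,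
    Chk.ex, Chk.mem, Expr.reads, rels, methods, conf, query, accRel, accBind, name, doms, tuple,
    query', method, methodDoms]

/-- The guess is an arbitrary tree, not assumed to encode anything, so the meaning of the check is
first stated for raw trees. -/
theorem holds_check_iff {Ω : Set STree} {σ : ℕ → STree}
    {tRels tMeth tConf tQ tR tBind tIn : STree}
    (h0 : σ 0 = .node (.node tRels tMeth) (.node tConf (.node tQ (.node (.node tR tIn) tBind))))
    {g N D T Q' M MD : STree} (h1 : σ 1 = g) (hN : N = g.hd) (hD : D = g.tl.hd)
    (hT : T = g.tl.tl.hd) (hQ' : Q' = g.tl.tl.tl.hd) (hM : M = g.tl.tl.tl.tl.hd)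
    (hMD : MD = g.tl.tl.tl.tl.tl) :
    check.Holds Ω 2 σ ↔ .node tR D ∈ tRels.elems ∧
      List.Forall₂ (fun o v => o = .node .nil v) tBind.elems T.elems ∧
      .node (.node (.node (.node N D) tRels) tMeth)
        (.node (.node (.node N T) tConf) (.node Q' Q')) ∈ Ω ∧
      .node (.node (.node (.node N D) tRels) tMeth)
        (.node (.node (.node N T) tConf) (.node Q' tQ)) ∉ Ω ∧
      (List.Forall₂ (fun A B => B.tl = A.tl ∧ (B.hd = A.hd ∨ A.hd = tR ∧ B.hd = N))
          tQ.elems Q'.elems ∨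
        .node (.node (.node (.node N .nil) tRels) tMeth)
          (.node (.node (.node tR T) tConf) (.node tQ (.node (.node N .nil) .nil))) ∉ Ω ∧
        M ∈ tMeth.elems ∧ M.tl.tl ≠ .nil ∧ .node M.hd MD ∈ tRels.elems ∧
        List.Forall₂ (fun i d => i = .nil ∨ ∃ A ∈ Q'.elems,
          ∃ r ∈ STree.node N D :: tRels.elems, A.hd = r.hd ∧ d ∈ r.tl.elems)
          M.tl.hd.elems MD.elems ∧
        ¬ List.Forall₂ (fun i d => ¬ (i ≠ .nil ∧ ¬ List.Forall₂ (fun c d' => ¬ (d' = d ∧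
          .node (.node (.node (.node N (.node d .nil)) tRels) tMeth)
            (.node tConf (.node
              (.node (.node N (.node (.node (.node .nil .nil) c) .nil)) .nil)
              (.node (.node N (.node (.node (.node .nil .nil) c) .nil)) .nil))) ∉ Ω))
          T.elems D.elems)) M.tl.hd.elems MD.elems) := by
  subst hN hD hT hQ' hM hMD
  rw [check]
  simp only [Chk.Holds, Chk.holds_or, redirect, newAccess, inhabited, newConst]
  rw [Chk.holds_mem (by simp [Expr.reads, accRel, doms]),
    Chk.holds_mem (by simp [Expr.reads, method]),
    Chk.holds_mem (by simp [Expr.reads, method, methodDoms])]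
  simp only [Chk.Holds, Chk.holds_ex]
  simp only [Chk.holds_mem (show ∀ i ∈ (Expr.reg 4).reads, i ≤ 17 by simp [Expr.reads])]
  simp [Expr.eval, constQuery, ask, rels, methods, conf, query, accRel, accBind,
    name, doms, tuple, query', method, methodDoms, h0, h1, STree.hd, STree.tl, STree.elems]

end RelevanceCheck
open TreeEncoding (enc enc_injective)

/-! ## Encodings -/

section Encoding

variable {α β : Type} [TreeEncoding α] [TreeEncoding β]

theorem elems_enc (l : List α) : (enc l).elems = l.map enc := by
  induction l with
  | nil => rfl
  | cons a l ih => rw [List.map_cons, ← ih]; rfl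

theorem enc_inj {a b : α} : enc a = enc b ↔ a = b := enc_injective.eq_iff

theorem size_enc_le_of_mem {a : α} {l : List α} (h : a ∈ l) :
    (enc a).size + 1 ≤ (enc l).size := by
  induction l with
  | nil => simp at h
  | cons b l ih =>
    have : (enc (b :: l)).size = 1 + (enc b).size + (enc l).size := rfl
    rcases List.mem_cons.1 h with rfl | h
    · have := (enc l).size_pos; omega
    · have := ih h; omega

theorem two_mul_length_lt_size_enc (l : List α) : 2 * l.length < (enc l).size := by
  induction l with
  | nil => exact Nat.zero_lt_one
  | cons b l ih =>
    have : (enc (b :: l)).size = 1 + (enc b).size + (enc l).size := rfl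
    have := (enc b).size_pos
    rw [List.length_cons]
    omega

theorem size_enc_list_le {l : List α} {B : ℕ} (h : ∀ a ∈ l, (enc a).size ≤ B) :
    (enc l).size ≤ 1 + l.length * (1 + B) := by
  induction l with
  | nil => exact Nat.le_add_right _ _
  | cons b l ih =>
    have h1 : (enc (b :: l)).size = 1 + (enc b).size + (enc l).size := rfl
    have h2 := ih fun a ha => h a (List.mem_cons_of_mem _ ha)
    have h3 := h b List.mem_cons_self
    rw [List.length_cons, Nat.succ_mul]
    omega

theorem size_enc_name_le (x : Name) : (enc x).size ≤ 1 + x.length * 4 :=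
  size_enc_list_le fun b _ => STree.size_ofBool_le b

theorem size_enc_le_size_enc_map_some (t : List Name) :
    (enc t).size ≤ (enc (t.map some)).size := by
  induction t with
  | nil => exact le_rfl
  | cons a t ih =>
    have h1 : (enc (a :: t)).size = 1 + (enc a).size + (enc t).size := rfl
    have h2 : (enc ((a :: t).map some)).size =
      1 + (1 + 1 + (enc a).size) + (enc (t.map some)).size := rfl
    omega

theorem enc_list_eq_node {l : List α} {a b : STree} (h : enc l = .node a b) :
    ∃ x l', l = x :: l' ∧ enc x = a ∧ enc l' = b := by
  cases l with
  | nil => cases h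
  | cons x l' =>
    have h' : STree.node (enc x) (enc l') = .node a b := h
    rw [STree.node.injEq] at h'
    exact ⟨x, l', rfl, h'.1, h'.2⟩

end Encoding

theorem exists_pair_of_not_forall₂ {α β : Type*} {R : α → β → Prop} {l : List α} {l' : List β}
    (hl : l.length = l'.length) (h : ¬ List.Forall₂ (fun a b => ¬ R a b) l l') :
    ∃ a b, (a, b) ∈ l.zip l' ∧ R a b := by
  by_contra hcon
  exact h (List.forall₂_iff_zip.2 ⟨hl, fun {a b} hab hR => hcon ⟨a, b, hab, hR⟩⟩)

theorem not_forall₂_of_pair {α β : Type*} {R : α → β → Prop} {l : List α} {l' : List β} {a : α}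
    {b : β} (hab : (a, b) ∈ l.zip l') (hR : R a b) : ¬ List.Forall₂ (fun a b => ¬ R a b) l l' :=
  fun h => (List.forall₂_iff_zip.1 h).2 hab hR

/-! ### Answers of the containment oracle and validity of queries -/

/-- The positive answers of the containment oracle. -/
theorem enc_mem_oracle_iff {dom : Name → Set Name} {S : Schema} {C : List Fact} {Q₁ Q₂ : CQ} :
    enc (S, C, Q₁, Q₂) ∈ enc '' {y : ContainmentInput dom | ContainmentProblem dom y} ↔
      S.Valid ∧ IsInstance dom S C.toFinset ∧ CQ.Valid S C.toFinset Q₁ ∧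
        CQ.Valid S C.toFinset Q₂ ∧ ContainedFrom dom S C.toFinset Q₁ Q₂ := by
  constructor
  · rintro ⟨y, hy, h⟩
    have h' : (y.schema, y.conf, y.query₁, y.query₂) = (S, C, Q₁, Q₂) := enc_injective h
    simp only [Prod.mk.injEq] at h'
    obtain ⟨rfl, rfl, rfl, rfl⟩ := h'
    exact ⟨y.schema_valid, y.conf_valid, y.query₁_valid, y.query₂_valid, hy⟩
  · rintro ⟨h1, h2, h3, h4, h5⟩
    exact ⟨⟨S, C, Q₁, Q₂, h1, h2, h3, h4⟩, h5, rfl⟩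

section Main

variable {dom : Name → Set Name}

/-- The guess that consists of the given parts. -/
def guessTree (n : Name) (es t : List Name) (Q' : CQ) (M MD : STree) : STree :=
  .node (enc n) (.node (enc es) (.node (enc t) (.node (enc Q') (.node M MD))))

theorem containedFrom_refl {S : Schema} {C : Finset Fact} {Q : CQ} : ContainedFrom dom S C Q Q :=
  fun _ _ h => h

theorem CQ.Valid.extend {S : Schema} {n : Name} {es : List Name} (hn : n ∉ S.rels.map Prod.fst)
    {C D : Finset Fact} {Q : CQ} (hQ : CQ.Valid S C Q)
    (hCD : adom S C ⊆ adom (S.extend n es) D) : CQ.Valid (S.extend n es) D Q := by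
  have hocc : ∀ t d, CQ.Occurs (S.extend n es) Q t d → CQ.Occurs S Q t d := by
    rintro t d ⟨A, hA, ds, h1, h2⟩
    obtain ⟨ds', h1', -⟩ := hQ.1 A hA
    exact ⟨A, hA, ds, (mem_extend_rels_of_ne (ne_of_mem_rels hn h1')).1 h1, h2⟩
  refine ⟨fun A hA => ?_, fun x d d' h h' => hQ.2.1 x d d' (hocc _ _ h) (hocc _ _ h'),
    fun c d h => hCD (hQ.2.2 c d (hocc _ _ h))⟩
  obtain ⟨ds, h1, h2⟩ := hQ.1 A hA
  exact ⟨ds, List.mem_cons_of_mem _ h1, h2⟩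

/-- Since `n` copies the domains of `r`, every term keeps the domains in which it occurs. -/
theorem CQ.Valid.redirect {S : Schema} (hS : S.Valid) {r n : Name} {es : List Name}
    (hn : n ∉ S.rels.map Prod.fst) (hr : (r, es) ∈ S.rels) {C D : Finset Fact} {Q Q' : CQ}
    (hQ : CQ.Valid S C Q) (hCD : adom S C ⊆ adom (S.extend n es) D)
    (hQQ' : List.Forall₂ (Atom.Redirect r n) Q Q') : CQ.Valid (S.extend n es) D Q' := by
  have hback : ∀ B ∈ Q', ∃ A ∈ Q, Atom.Redirect r n A B := fun B hB =>
    List.Forall₂.exists_of_mem (R := fun B A => Atom.Redirect r n A B)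
      (List.Forall₂.flip hQQ') hB
  have hdom : ∀ A ∈ Q, ∀ B, Atom.Redirect r n A B → ∀ ds, (B.rel, ds) ∈ (S.extend n es).rels →
      (A.rel, ds) ∈ S.rels := by
    rintro A hA B ⟨-, hB | ⟨hA', hB⟩⟩ ds hds
    · rw [hB] at hds
      obtain ⟨ds', h1', -⟩ := hQ.1 A hA
      exact (mem_extend_rels_of_ne (ne_of_mem_rels hn h1')).1 hds
    · rw [hB] at hds
      rw [hA', (hS.extend hn).unique hds List.mem_cons_self]
      exact hr
  have hocc : ∀ t d, CQ.Occurs (S.extend n es) Q' t d → CQ.Occurs S Q t d := by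
    rintro t d ⟨B, hB, ds, h1, h2⟩
    obtain ⟨A, hA, hAB⟩ := hback B hB
    exact ⟨A, hA, ds, hdom A hA B hAB ds h1, hAB.1 ▸ h2⟩
  refine ⟨fun B hB => ?_, fun x d d' h h' => hQ.2.1 x d d' (hocc _ _ h) (hocc _ _ h'),
    fun c d h => hCD (hQ.2.2 c d (hocc _ _ h))⟩
  obtain ⟨A, hA, hargs, hrel⟩ := hback B hB
  obtain ⟨ds, h1, h2⟩ := hQ.1 A hA
  rcases hrel with hrel | ⟨hA', hrel⟩
  · exact ⟨ds, by rw [hrel]; exact List.mem_cons_of_mem _ h1, by rw [hargs, h2]⟩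
  · rw [hA'] at h1
    exact ⟨es, by rw [hrel]; exact List.mem_cons_self, by rw [hargs, h2, hS.unique h1 hr]⟩

/-- The query that the constant `c` is in the unary relation `n`. -/
def constCQ (n c : Name) : CQ := [⟨n, [.const c]⟩]

/-- A valid query has only constants that are active in the right domain. The relation `n` is empty,
so presence of `c` is decided by the old facts. -/
theorem enc_mem_oracle_constCQ_iff {S : Schema} (hS : S.Valid) {n c d : Name}
    (hn : n ∉ S.rels.map Prod.fst) {C : List Fact} (hC : IsInstance dom S C.toFinset) :
    enc (S.extend n [d], C, constCQ n c, constCQ n c) ∈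
      enc '' {y : ContainmentInput dom | ContainmentProblem dom y} ↔
        (c, d) ∈ adom S C.toFinset := by
  rw [enc_mem_oracle_iff]
  constructor
  · rintro ⟨-, -, h, -⟩
    rw [← adom_extend hn hC]
    exact h.2.2 c d ⟨_, List.mem_singleton_self _, [d], List.mem_cons_self, by simp⟩
  · intro h
    have hocc : ∀ t d', CQ.Occurs (S.extend n [d]) (constCQ n c) t d' → t = .const c ∧ d' = d := by
      rintro t d' ⟨A, hA, ds, h1, h2⟩
      obtain rfl := List.mem_singleton.1 hA
      rw [(hS.extend hn).unique h1 List.mem_cons_self] at h2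
      simpa using h2
    have hval : CQ.Valid (S.extend n [d]) C.toFinset (constCQ n c) := by
      refine ⟨fun A hA => ?_, fun x d d' h _ => ?_, fun c' d' h' => ?_⟩
      · obtain rfl := List.mem_singleton.1 hA
        exact ⟨[d], List.mem_cons_self, rfl⟩
      · cases (hocc _ _ h).1
      · obtain ⟨h1, rfl⟩ := hocc _ _ h'
        cases h1
        rwa [adom_extend hn hC]
    exact ⟨hS.extend hn, hC.extend, hval, hval, containedFrom_refl⟩

theorem toFinset_cons_eq_union (C : List Fact) (f : Fact) :
    (f :: C).toFinset = C.toFinset ∪ {f} := by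
  rw [List.toFinset_cons, Finset.insert_eq, Finset.union_comm]

/-- The oracle query whether the query `Q` is unsatisfiable from `C`. -/
theorem enc_mem_oracle_reach_iff {S : Schema} (hS : S.Valid) {n : Name}
    (hn : n ∉ S.rels.map Prod.fst) {C : List Fact} (hC : IsInstance dom S C.toFinset) {Q : CQ}
    (hQ : CQ.Valid S C.toFinset Q) :
    enc (S.extend n [], C, Q, ([⟨n, []⟩] : CQ)) ∈
      enc '' {y : ContainmentInput dom | ContainmentProblem dom y} ↔
        ¬ ∃ C', Reachable dom S C.toFinset C' ∧ CQ.Holds Q C' := by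
  rw [enc_mem_oracle_iff]
  have hval : CQ.Valid (S.extend n []) C.toFinset [⟨n, []⟩] := by
    have hocc : ∀ t d', ¬ CQ.Occurs (S.extend n []) [⟨n, []⟩] t d' := by
      rintro t d' ⟨A, hA, ds, h1, h2⟩
      obtain rfl := List.mem_singleton.1 hA
      simp at h2
    refine ⟨fun A hA => ?_, fun x d d' h _ => absurd h (hocc _ _), fun c' d' h => absurd h (hocc _ _)⟩
    obtain rfl := List.mem_singleton.1 hA
    exact ⟨[], List.mem_cons_self, rfl⟩
  constructor
  · rintro ⟨-, -, -, -, h⟩ ⟨C', h1, h2⟩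
    -- The nullary relation stays empty along every path, so its query is never true.
    obtain ⟨v, hv⟩ := h C' ((reachable_extend_iff' hS hn hC).2 h1) h2
    obtain ⟨I, hI, hCI, p, hp, rfl⟩ := h1
    exact (hI.mono (hp.endConf_subset hCI)).rel_ne hn (hv _ (List.mem_singleton_self _)) rfl
  · intro h
    exact ⟨hS.extend hn, hC.extend, hQ.extend hn (adom_extend hn hC).symm.subset, hval,
      fun C' h1 h2 => absurd ⟨C', (reachable_extend_iff' hS hn hC).1 h1, h2⟩ h⟩

theorem CQ.Valid.mono {S : Schema} {C D : Finset Fact} {Q : CQ} (hQ : CQ.Valid S C Q)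
    (h : adom S C ⊆ adom S D) : CQ.Valid S D Q :=
  ⟨hQ.1, hQ.2.1, fun c d hcd => h (hQ.2.2 c d hcd)⟩

end Main
-- Soundness of the check
section Main

variable {dom : Name → Set Name}

theorem subset_adom_extend_union {S : Schema} {n : Name} {es : List Name}
    (hn : n ∉ S.rels.map Prod.fst) {C D : Finset Fact} (hC : IsInstance dom S C) :
    adom S C ⊆ adom (S.extend n es) (C ∪ D) := by
  rw [← adom_extend (es := es) hn hC]
  exact adom_mono Finset.subset_union_left

theorem RelevanceCheck.sound (hdom : ∀ d, (dom d).Infinite) (x : RelevanceInput dom)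
    (σ : ℕ → STree) (h0 : σ 0 = enc x)
    (h : check.Holds (enc '' {y : ContainmentInput dom | ContainmentProblem dom y}) 2 σ) :
    RelevanceProblem dom x := by
  have hC := x.conf_valid
  have hS := x.schema_valid
  have hQ := x.query_valid
  have ha := x.access_wellFormed
  rw [holds_check_iff (tRels := enc x.schema.rels) (tMeth := enc x.schema.methods)
    (tConf := enc x.conf) (tQ := enc x.query) (tR := enc x.access.method.rel)
    (tBind := enc x.access.bind)
    (tIn := .node (enc x.access.method.input) (enc x.access.method.dependent))
    h0 rfl rfl rfl rfl rfl rfl rfl] at h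
  generalize (σ 1).hd = N at h
  generalize (σ 1).tl.hd = D at h
  generalize (σ 1).tl.tl.hd = T at h
  generalize (σ 1).tl.tl.tl.hd = Q' at h
  generalize (σ 1).tl.tl.tl.tl.hd = M at h
  generalize (σ 1).tl.tl.tl.tl.tl = MD at h
  -- The positive answer comes with a genuine containment input `y`; comparing encodings decodes the
  -- name, domains, tuple and query of the guess.
  obtain ⟨h1, h2, ⟨y, -, hy⟩, h4, h5⟩ := h
  have hy' : STree.node (.node (enc y.schema.rels) (enc y.schema.methods))
    (.node (enc y.conf) (.node (enc y.query₁) (enc y.query₂))) = _ := hy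
  simp only [STree.node.injEq] at hy'
  obtain ⟨⟨e1, e2⟩, e3, rfl, -⟩ := hy'
  obtain ⟨⟨n, es⟩, rs, hrels, hx, hrs⟩ := enc_list_eq_node e1
  obtain ⟨⟨n', t⟩, cs, hconf, hx', hcs⟩ := enc_list_eq_node e3
  have hx2 : STree.node (enc n) (enc es) = .node N D := hx
  have hx2' : STree.node (enc n') (enc t) = .node N T := hx'
  rw [STree.node.injEq] at hx2 hx2'
  obtain ⟨rfl, rfl⟩ := hx2
  obtain ⟨hnn, rfl⟩ := hx2'
  obtain rfl := enc_injective hnn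
  obtain rfl := enc_injective hrs
  obtain rfl := enc_injective hcs
  replace e2 := enc_injective e2
  have hschema : y.schema = x.schema.extend n' es := by
    rcases hys : y.schema with ⟨R, M⟩
    simp only [hys] at hrels e2
    rw [hrels, e2]
    rfl
  have hy1 := y.schema_valid
  have hy2 := y.conf_valid
  have hy3 := y.query₁_valid
  rw [hschema] at hy1 hy2 hy3
  rw [hconf] at hy2 hy3
  generalize y.query₁ = q at *
  have hn := hy1.fresh_of_extend
  have hr : (x.access.method.rel, es) ∈ x.schema.rels := by
    rw [elems_enc] at h1
    obtain ⟨⟨r, e⟩, hre, heq⟩ := List.mem_map.1 h1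
    have heq' : STree.node (enc r) (enc e) = .node (enc x.access.method.rel) (enc es) := heq
    rw [STree.node.injEq, enc_inj, enc_inj] at heq'
    obtain ⟨rfl, rfl⟩ := heq'
    exact hre
  have hat : x.access.bind = t.map some := by
    rw [elems_enc, elems_enc, List.forall₂_map_left_iff, List.forall₂_map_right_iff] at h2
    rw [← List.forall₂_eq_eq_eq, List.forall₂_map_right_iff]
    exact h2.imp fun o v hov => enc_injective hov
  have ht := ha.wellTyped hS hat
  -- A negative answer could also mean invalid input; since validity is known by now, it means
  -- failure of containment.
  have hnot : ¬ ContainedFrom dom (x.schema.extend n' es) (x.conf.toFinset ∪ {(n', t)}) q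
      x.query := by
    intro hcont
    rw [← toFinset_cons_eq_union] at hcont
    refine h4 (enc_mem_oracle_iff.2 ⟨hy1, hy2, hy3, hQ.extend hn ?_, hcont⟩)
    rw [toFinset_cons_eq_union]
    exact subset_adom_extend_union hn hC
  rcases h5 with h5 | ⟨h5, h6, h7, h8, h9, h10⟩
  · refine longTermRelevant_of_redirect hS hn hC hQ ha hat hr ?_ hnot
    rw [elems_enc, elems_enc, List.forall₂_map_left_iff, List.forall₂_map_right_iff] at h5
    exact h5.imp fun A B hAB => ⟨enc_injective hAB.1, hAB.2.imp (fun h => enc_injective h)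
      fun h => ⟨enc_injective h.1, enc_injective h.2⟩⟩
  · rw [elems_enc] at h6
    obtain ⟨m, hm, rfl⟩ := List.mem_map.1 h6
    have hdep : m.dependent = true := by
      rcases hmd : m.dependent with _ | _
      · refine absurd ?_ h7
        change enc m.dependent = STree.nil
        rw [hmd]
        rfl
      · rfl
    rw [elems_enc] at h8
    obtain ⟨⟨r, ds⟩, hrd, heq⟩ := List.mem_map.1 h8
    have heq' : STree.node (enc r) (enc ds) = .node (enc m.rel) MD := heq
    rw [STree.node.injEq, enc_inj] at heq'
    obtain ⟨rfl, rfl⟩ := heq'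
    have hmi : (enc m).tl.hd = enc m.input := rfl
    rw [hmi, elems_enc m.input, elems_enc ds, List.forall₂_map_left_iff,
      List.forall₂_map_right_iff] at h9 h10
    obtain ⟨i, d, hid, hi, hcd⟩ := exists_pair_of_not_forall₂ h9.length_eq h10
    have hi' : i = true := by
      cases i
      · exact absurd rfl hi
      · rfl
    subst hi'
    rw [elems_enc, elems_enc, List.forall₂_map_left_iff, List.forall₂_map_right_iff] at hcd
    obtain ⟨c, d', hcd', hdd, hnew⟩ := exists_pair_of_not_forall₂ (ht.forall₂ hS hr).length_eq hcd
    obtain rfl := enc_injective hdd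
    have hreach : ∃ C₂, Reachable dom x.schema
        (x.conf.toFinset ∪ {(x.access.method.rel, t)}) C₂ ∧ CQ.Holds x.query C₂ := by
      by_contra hcon
      rw [← toFinset_cons_eq_union] at hcon
      refine h5 ((enc_mem_oracle_reach_iff hS hn ?_ (hQ.mono ?_)).2 hcon)
      · rw [toFinset_cons_eq_union]
        exact hC.union (isInstance_singleton.2 ht)
      · rw [toFinset_cons_eq_union]
        exact adom_mono Finset.subset_union_left
    obtain ⟨C₂, hC₂, hQC₂⟩ := hreach
    refine longTermRelevant_of_new_access hdom hS hn hC hQ ha hat hr hnot hC₂ hQC₂ hm hdep hrd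
      (fun d hd => ?_) hid hcd' fun hcon => ?_
    · rcases (List.forall₂_iff_zip.1 h9).2 hd with hcon | ⟨A, hA, r, hr', hAr, hd'⟩
      · exact absurd hcon (by rintro ⟨⟩)
      · rw [elems_enc] at hA
        obtain ⟨A', hA', rfl⟩ := List.mem_map.1 hA
        have : ∃ y ∈ (x.schema.extend n' es).rels, enc y = r := by
          rcases List.mem_cons.1 hr' with rfl | hr'
          · exact ⟨(n', es), List.mem_cons_self, rfl⟩
          · rw [elems_enc] at hr'
            obtain ⟨y, hy, rfl⟩ := List.mem_map.1 hr'
            exact ⟨y, List.mem_cons_of_mem _ hy, rfl⟩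
        obtain ⟨⟨r', ds'⟩, hy, rfl⟩ := this
        have hrel : A'.rel = r' := enc_injective hAr
        have hd2 : enc d ∈ (enc ds').elems := hd'
        rw [elems_enc] at hd2
        obtain ⟨d2, hd3, hd4⟩ := List.mem_map.1 hd2
        obtain rfl := enc_injective hd4
        exact ⟨A', hA', ds', hrel ▸ hy, hd3⟩
    · exact hnew ((enc_mem_oracle_constCQ_iff hS hn hC).2 hcon)

/-! ### Size of the guess, and completeness of the check -/

/-- A name that is longer than all names of relations. -/
theorem replicate_notMem_rels (x : RelevanceInput dom) :
    List.replicate (enc x).size false ∉ x.schema.rels.map Prod.fst := by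
  intro h
  obtain ⟨⟨r, ds⟩, hr, heq⟩ := List.mem_map.1 h
  have h1 := size_enc_le_of_mem hr
  have h2 : (enc (r, ds)).size = 1 + (enc r).size + (enc ds).size := rfl
  have h3 := two_mul_length_lt_size_enc r
  have h4 : (enc x).size = 1 + (1 + (enc x.schema.rels).size + (enc x.schema.methods).size) +
    (enc (x.conf, x.query, x.access)).size := rfl
  have h5 : r.length = (enc x).size := by rw [show r = _ from heq]; simp
  omega

theorem size_enc_redirect_le {r n : Name} {Q Q' : CQ} (h : List.Forall₂ (Atom.Redirect r n) Q Q') :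
    (enc Q').size ≤ 1 + (enc Q).size * (1 + ((enc Q).size + (enc n).size)) := by
  have hl := two_mul_length_lt_size_enc Q
  rw [h.length_eq] at hl
  refine (size_enc_list_le (B := (enc Q).size + (enc n).size) fun B hB => ?_).trans
    (Nat.add_le_add_left (Nat.mul_le_mul_right _ (by omega)) _)
  obtain ⟨A, hA, hargs, hrel⟩ := List.Forall₂.exists_of_mem (R := fun B A => Atom.Redirect r n A B)
    (List.Forall₂.flip h) hB
  have h1 := size_enc_le_of_mem hA
  have h2 : (enc A).size = 1 + (enc A.rel).size + (enc A.args).size := rfl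
  have h3 : (enc B).size = 1 + (enc B.rel).size + (enc B.args).size := rfl
  rw [hargs] at h3
  rcases hrel with hrel | ⟨-, hrel⟩ <;> rw [hrel] at h3 <;> omega

/-- At most X variables, each with a name of length at most 2X + 1, give a quadratic bound. -/
theorem size_enc_genericAtom_le (x : Name × List Name) {X : ℕ} (h1 : x.1.length ≤ X)
    (h2 : x.2.length ≤ X) : (enc (genericAtom x)).size ≤ 8 * X * X + 16 * X + 4 := by
  have h3 : (enc (genericAtom x)).size = 1 + (enc x.1).size + (enc (genericAtom x).args).size := rfl
  have h4 := size_enc_name_le x.1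
  have h5 := size_enc_list_le (l := (genericAtom x).args) (B := 8 * X + 7) (by
    intro t ht
    obtain ⟨j, hj, rfl⟩ := List.mem_map.1 ht
    have h6 : (enc (Term.var (attributeVar x.1 j))).size =
      1 + 1 + (enc (attributeVar x.1 j)).size := rfl
    have h7 := size_enc_name_le (attributeVar x.1 j)
    have h8 : (attributeVar x.1 j).length = j + (x.1.length + 1) := by simp [attributeVar]
    have h9 := List.mem_range.1 hj
    omega)
  have h6 : (genericAtom x).args.length = x.2.length := by simp [genericAtom]
  rw [h6] at h5
  have h7 : x.2.length * (1 + (8 * X + 7)) ≤ X * (1 + (8 * X + 7)) := Nat.mul_le_mul_right _ h2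
  have h8 : X * (1 + (8 * X + 7)) = 8 * X * X + 8 * X := by ring
  omega

theorem size_enc_genericQuery_le {S : Schema} {n : Name} {es : List Name}
    {L : List (Name × List Name)} (hL : L.Sublist (S.extend n es).rels) {X : ℕ}
    (hX : (enc S.rels).size ≤ X) (hn : n.length ≤ X) (hes : es.length ≤ X) :
    (enc (genericQuery L)).size ≤ 1 + (X + 1) * (1 + (8 * X * X + 16 * X + 4)) := by
  have hlen : (genericQuery L).length ≤ X + 1 := by
    have h1 := hL.length_le
    have h2 := two_mul_length_lt_size_enc S.rels
    simp only [Schema.extend, List.length_cons] at h1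
    rw [genericQuery, List.length_map]
    omega
  refine (size_enc_list_le (B := 8 * X * X + 16 * X + 4) fun A hA => ?_).trans
    (Nat.add_le_add_left (Nat.mul_le_mul_right _ hlen) _)
  obtain ⟨x, hx, rfl⟩ := List.mem_map.1 hA
  rcases List.mem_cons.1 (hL.subset hx) with rfl | hx
  · exact size_enc_genericAtom_le _ hn hes
  · have h1 := size_enc_le_of_mem hx
    have h2 : (enc x).size = 1 + (enc x.1).size + (enc x.2).size := rfl
    have h3 := two_mul_length_lt_size_enc x.1
    have h4 := two_mul_length_lt_size_enc x.2
    exact size_enc_genericAtom_le x (by omega) (by omega)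

theorem size_enc_relevanceInput (x : RelevanceInput dom) :
    (enc x).size = 5 + (enc x.schema.rels).size + (enc x.schema.methods).size +
      (enc x.conf).size + (enc x.query).size + (enc x.access.method).size +
      (enc x.access.bind).size ∧ 5 ≤ (enc x.access.method).size := by
  have h1 : (enc x).size = 1 + (1 + (enc x.schema.rels).size + (enc x.schema.methods).size) +
    (1 + (enc x.conf).size + (1 + (enc x.query).size +
      (1 + (enc x.access.method).size + (enc x.access.bind).size))) := rfl
  have h2 : (enc x.access.method).size = 1 + (enc x.access.method.rel).size +
    (1 + (enc x.access.method.input).size + (enc x.access.method.dependent).size) := rfl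
  have h3 := (enc x.access.method.rel).size_pos
  have h4 := (enc x.access.method.input).size_pos
  have h5 := (enc x.access.method.dependent).size_pos
  omega

theorem RelevanceCheck.complete (x : RelevanceInput dom) (h : RelevanceProblem dom x) :
    ∃ g : STree, g.size ≤ (enc x).size ^ (4 + 1) ∧ ∀ σ : ℕ → STree, σ 0 = enc x → σ 1 = g →
      check.Holds (enc '' {y : ContainmentInput dom | ContainmentProblem dom y}) 2 σ := by
  have hC := x.conf_valid
  have hS := x.schema_valid
  have hQ := x.query_valid
  have ha := x.access_wellFormed
  obtain ⟨t, hat⟩ := x.access_boolean.exists_tuple ha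
  obtain ⟨es, hr⟩ := ha.rel_mem
  have ht := ha.wellTyped hS hat
  obtain ⟨hX1, hX2⟩ := size_enc_relevanceInput x
  set n : Name := List.replicate (enc x).size false with hndef
  have hn : n ∉ x.schema.rels.map Prod.fst := replicate_notMem_rels x
  have hX : 10 ≤ (enc x).size := by
    have := (enc x.schema.rels).size_pos
    have := (enc x.schema.methods).size_pos
    have := (enc x.conf).size_pos
    omega
  have hsize : ∀ (Q' : CQ) (M MD : STree),
      (enc Q').size ≤ 1 + ((enc x).size + 1) *
        (1 + (8 * (enc x).size * (enc x).size + 16 * (enc x).size + 4)) →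
      M.size ≤ (enc x).size → MD.size ≤ (enc x).size →
      (guessTree n es t Q' M MD).size ≤ (enc x).size ^ (4 + 1) := by
    intro Q' M MD hq hM hMD
    have h1 : (guessTree n es t Q' M MD).size = 1 + (enc n).size + (1 + (enc es).size +
      (1 + (enc t).size + (1 + (enc Q').size + (1 + M.size + MD.size)))) := rfl
    have h2 := size_enc_name_le n
    have h3 : n.length = (enc x).size := by simp [n]
    have h4 := size_enc_le_size_enc_map_some t
    rw [← hat] at h4
    have h5 := size_enc_le_of_mem hr
    have h6 : (enc (x.access.method.rel, es)).size =
      1 + (enc x.access.method.rel).size + (enc es).size := rfl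
    generalize (enc x).size = X at *
    have h7 : (guessTree n es t Q' M MD).size ≤ 6 + 4 * X + 4 * X + (1 + (X + 1) *
      (1 + (8 * X * X + 16 * X + 4))) := by omega
    refine h7.trans ?_
    -- The bound for the guess is cubic; for X ≥ 10 the fifth power exceeds it, and after the
    -- substitution X = 10 + k this is a comparison of coefficients.
    obtain ⟨k, rfl⟩ := Nat.exists_eq_add_of_le hX
    ring_nf
    nlinarith [Nat.zero_le k, Nat.zero_le (k ^ 2), Nat.zero_le (k ^ 3), Nat.zero_le (k ^ 4),
      Nat.zero_le (k ^ 5)]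
  have key : ∀ Q' : CQ,
      CQ.Valid (x.schema.extend n es) (x.conf.toFinset ∪ {(n, t)}) Q' →
      ¬ ContainedFrom dom (x.schema.extend n es) (x.conf.toFinset ∪ {(n, t)}) Q' x.query →
      STree.node (enc x.access.method.rel) (enc es) ∈ (enc x.schema.rels).elems ∧
      List.Forall₂ (fun o v => o = .node .nil v) (enc x.access.bind).elems (enc t).elems ∧
      enc (x.schema.extend n es, (n, t) :: x.conf, Q', Q') ∈
        enc '' {y : ContainmentInput dom | ContainmentProblem dom y} ∧
      enc (x.schema.extend n es, (n, t) :: x.conf, Q', x.query) ∉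
        enc '' {y : ContainmentInput dom | ContainmentProblem dom y} := by
    intro Q' hval hnot
    refine ⟨?_, ?_, ?_, ?_⟩
    · rw [elems_enc]
      exact List.mem_map.2 ⟨_, hr, rfl⟩
    · rw [elems_enc, elems_enc, List.forall₂_map_left_iff, List.forall₂_map_right_iff, hat,
        List.forall₂_map_left_iff, List.forall₂_same]
      exact fun v _ => rfl
    · rw [enc_mem_oracle_iff, toFinset_cons_eq_union]
      exact ⟨hS.extend hn, hC.extend.union (isInstance_singleton.2
        ⟨es, List.mem_cons_self, ht.forall₂ hS hr⟩), hval, hval, containedFrom_refl⟩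
    · rw [enc_mem_oracle_iff, toFinset_cons_eq_union]
      exact fun h => hnot h.2.2.2.2
  rcases h.redirect_or_new_access hS hn hC hQ ha hat hr with
    ⟨Q', hQQ', hnot⟩ | ⟨hreach, L, m, ds, c, d, hL, hnot, hm, hdep, hds, hinp, hd, hcd, hnew⟩
  · have hval := hQ.redirect hS hn hr (subset_adom_extend_union (D := {(n, t)}) hn hC) hQQ'
    obtain ⟨k1, k2, k3, k4⟩ := key Q' hval hnot
    -- Method and method domains play no role in the case of redirected atoms, so they are left
    -- empty.
    refine ⟨guessTree n es t Q' .nil .nil, hsize _ _ _ ?_ (by rw [STree.size]; omega)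
      (by rw [STree.size]; omega), fun σ h0 h1 => ?_⟩
    · have h1 := size_enc_redirect_le hQQ'
      have h2 := size_enc_name_le n
      have h3 : n.length = (enc x).size := by simp [n]
      have h4 : (enc x.query).size ≤ (enc x).size := by omega
      generalize (enc x).size = X at *
      have h5 : (enc x.query).size * (1 + ((enc x.query).size + (enc n).size)) ≤
        X * (1 + (X + (1 + X * 4))) := Nat.mul_le_mul h4 (by omega)
      nlinarith
    · rw [holds_check_iff (tRels := enc x.schema.rels) (tMeth := enc x.schema.methods)
        (tConf := enc x.conf) (tQ := enc x.query) (tR := enc x.access.method.rel)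
        (tBind := enc x.access.bind)
        (tIn := .node (enc x.access.method.input) (enc x.access.method.dependent))
        h0 h1 rfl rfl rfl rfl rfl rfl]
      refine ⟨k1, k2, k3, k4, .inl ?_⟩
      change List.Forall₂ _ (enc x.query).elems (enc Q').elems
      rw [elems_enc, elems_enc, List.forall₂_map_left_iff, List.forall₂_map_right_iff]
      exact hQQ'.imp fun A B hAB => ⟨congrArg enc hAB.1, hAB.2.imp (fun h => congrArg enc h)
        fun h => ⟨congrArg enc h.1, congrArg enc h.2⟩⟩
  · have hval := genericQuery_valid (hS.extend hn (es := es)) (x.conf.toFinset ∪ {(n, t)})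
      fun y hy => hL.subset hy
    obtain ⟨k1, k2, k3, k4⟩ := key (genericQuery L) hval hnot
    have hilen : m.input.length = ds.length := by
      obtain ⟨ds', h1, h2⟩ := hS.2 m hm
      rwa [hS.unique hds h1]
    refine ⟨guessTree n es t (genericQuery L) (enc m) (enc ds), hsize _ _ _ ?_ ?_ ?_,
      fun σ h0 h1 => ?_⟩
    · refine size_enc_genericQuery_le hL (by omega) (by simp [n]) ?_
      have h1 := size_enc_le_of_mem hr
      have h2 : (enc (x.access.method.rel, es)).size =
        1 + (enc x.access.method.rel).size + (enc es).size := rfl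
      have h3 := two_mul_length_lt_size_enc es
      omega
    · have := size_enc_le_of_mem hm
      omega
    · have h1 := size_enc_le_of_mem hds
      have h2 : (enc (m.rel, ds)).size = 1 + (enc m.rel).size + (enc ds).size := rfl
      omega
    · rw [holds_check_iff (tRels := enc x.schema.rels) (tMeth := enc x.schema.methods)
        (tConf := enc x.conf) (tQ := enc x.query) (tR := enc x.access.method.rel)
        (tBind := enc x.access.bind)
        (tIn := .node (enc x.access.method.input) (enc x.access.method.dependent))
        h0 h1 rfl rfl rfl rfl rfl rfl]
      refine ⟨k1, k2, k3, k4, .inr ⟨?_, ?_, ?_, ?_, ?_, ?_⟩⟩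
      · intro hmem
        refine (enc_mem_oracle_reach_iff (C := (x.access.method.rel, t) :: x.conf) hS hn ?_
          (hQ.mono ?_)).1 hmem ?_ <;> rw [toFinset_cons_eq_union]
        · exact hC.union (isInstance_singleton.2 ht)
        · exact adom_mono Finset.subset_union_left
        · exact hreach
      · rw [elems_enc]
        exact List.mem_map.2 ⟨m, hm, rfl⟩
      · change enc m.dependent ≠ STree.nil
        rw [hdep]
        rintro ⟨⟩
      · rw [elems_enc]
        exact List.mem_map.2 ⟨_, hds, rfl⟩
      · change List.Forall₂ _ (enc m.input).elems (enc ds).elems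
        rw [elems_enc m.input, elems_enc ds, List.forall₂_map_left_iff,
          List.forall₂_map_right_iff, List.forall₂_iff_zip]
        refine ⟨hilen, fun {i d} hid => ?_⟩
        cases i with
        | false => exact .inl rfl
        | true =>
          right
          obtain ⟨y, hy, hdy⟩ := hinp d hid
          refine ⟨enc (genericAtom y), ?_, enc y, ?_, rfl, ?_⟩
          · change _ ∈ (enc (genericQuery L)).elems
            rw [elems_enc]
            exact List.mem_map_of_mem (List.mem_map_of_mem hy)
          · rcases List.mem_cons.1 (hL.subset hy) with rfl | hy'
            · exact List.mem_cons_self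
            · rw [elems_enc]
              exact List.mem_cons_of_mem _ (List.mem_map_of_mem hy')
          · change _ ∈ (enc y.2).elems
            rw [elems_enc]
            exact List.mem_map_of_mem hdy
      · change ¬ List.Forall₂ _ (enc m.input).elems (enc ds).elems
        rw [elems_enc m.input, elems_enc ds, List.forall₂_map_left_iff,
          List.forall₂_map_right_iff]
        refine not_forall₂_of_pair hd ⟨by rintro ⟨⟩, ?_⟩
        change ¬ List.Forall₂ _ (enc t).elems (enc es).elems
        rw [elems_enc, elems_enc, List.forall₂_map_left_iff, List.forall₂_map_right_iff]
        refine not_forall₂_of_pair hcd ⟨rfl, fun hmem => hnew ?_⟩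
        exact (enc_mem_oracle_constCQ_iff hS hn hC).1 hmem

end Main

end DeepWeb

theorem mainTheorem7 (dom : DeepWeb.Name → Set DeepWeb.Name)
    (hdom : ∀ d, (dom d).Infinite) :
    DeepWeb.InNPOracle (DeepWeb.RelevanceProblem dom) (DeepWeb.ContainmentProblem dom) :=
  DeepWeb.inNPOracle_of_check _ _ DeepWeb.RelevanceCheck.check 4
    DeepWeb.RelevanceCheck.check_closed (DeepWeb.RelevanceCheck.sound hdom)
    DeepWeb.RelevanceCheck.complete
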